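/- **Setting.** Let $r\ge 1$, $m\ge 2$, $n$ be integers and let $\mathcal X$ consist of $n$ nodes for each pair of a domain in $[m]$ and a class in $[r]$, so $|\mathcal X|=N=rmn$; write $d_x$ and $y_x$ for the domain and class of $x$. Let $0\le\gamma$, $\rho\le 1$, $\rho>\max\{\alpha,\beta\}$ and $\min\{\alpha,\beta\}>\gamma$. A random undirected graph on $\mathcal X$ contains each unordered pair $\{x,x'\}$ (including $x=x'$) independently with probability $\rho$ if $y_x=y_{x'},d_x=d_{x'}$; $\alpha$ if $y_x=y_{x'},d_x\ne d_{x'}$; $\beta$ if $y_x\ne y_{x'},d_x=d_{x'}$; $\gamma$ if $y_x\ne y_{x'},d_x\ne d_{x'}$. Let $A$ be its adjacency matrix. Let $f:\mathcal X\to\mathbb R^{k}$, $k=r+m-1$, be any minimizer of the spectral contrastive loss $$-2\sum_{x,x'}\frac{A_{xx'}}{\sum_{z,z'}A_{zz'}}\,f(x)^\top f(x')+\frac1{N^2}\sum_{x,x'}\big(f(x)^\top f(x')\big)^2 .$$ Let $\mathcal S=\{x:d_x=1\}$ (source), $\mathcal T=\{x:d_x\neq1\}$ (target), $\vec y_x=e_{y_x}-\frac1r\mathbf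 1\in\mathbb R^r$, and let $\hat b\in\mathbb R^{k\times r}$ minimize $\sum_{x\in\mathcal S}\big(\|b^\top f(x)-\vec y_x\|_2^2+\eta\|b\|_F^2\big)$. Let $\mathrm{pred}(x)\in\arg\max_i(\hat b^\top f(x))_i$, with ties broken arbitrarily. Put $\delta=\min\{\alpha-\gamma,\beta-\gamma\}=\min\{\alpha,\beta\}-\gamma$. **Theorem (general case).** There is an absolute exponent $D\in\mathbb N$ such that for all $\zeta>0$ and $\epsilon\in(0,\frac12)$ there are constants $C_1,C_2>0$, depending only on $\zeta,\epsilon$, with the following property. For all $r,m,\rho,\alpha,\beta,\gamma$ as above and every $\eta\in\big(0,\frac{(\alpha-\gamma)\epsilon}{2r\rho}\big]$ there is $\tilde\xi\in[1-\epsilon,1]$ (not depending on $n$) such that for every $n\ge C_1\frac{rm}{\delta^2}$, with probability at least $1-n^{-\zeta}$, $$\sum_{x\in\mathcal T}\big\|\hat b^\top f(x)-\tilde\xi\,\vec y_x\big\|_2^2\le\frac{C_2}{\eta^4\delta^2}(rm)^D\qquad\text{and}\qquad \Pr_{x\sim\mathcal T}\big(\mathrm{pred}(x)\ne y_x\big)\le\frac{C_2}{\eta^4\delta^2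 n}(rm)^D,$$ where $x\sim\mathcal T$ is uniform. **Theorem (two domains).** There are an absolute exponent $D$ and absolute constants $C_1,C_2>0$ such that for $m=2$, $k=r+1$, every $\eta\in\big(0,\frac{\alpha-\gamma}{8r\rho}\big)$ and every $n\ge C_1\frac{r}{\delta^2}$, with probability at least $0.999$, $$\Pr_{x\sim\mathcal T}\big(\mathrm{pred}(x)\neq y_x\big)\le\frac{C_2}{\eta^4(\min\{\alpha,\beta\}-\gamma)^2n}\,r^D .$$ -/

import Mathlib

/-!
Stochastic block model on classes and domains, spectral contrastive pre-training on the sampled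
graph, and the ridge-regularized least-squares head fitted on the source domain.
-/

namespace SBM

/-- The nodes: `n` data points for each of the `m` domains and `r` classes. -/
abbrev Node (r m n : ℕ) : Type := Fin m × Fin r × Fin n

/-- The domain of a node. -/
def dom {r m n : ℕ} (x : Node r m n) : Fin m := x.1

/-- The class of a node. -/
def cls {r m n : ℕ} (x : Node r m n) : Fin r := x.2.1

/-- The source data: the nodes of the first domain. -/
def source (r m n : ℕ) : Finset (Node r m n) :=
  Finset.univ.filter fun x => (dom x : ℕ) = 0

/-- The target data: the nodes of all other domains. -/
def target (r m n : ℕ) : Finset (Node r m n) :=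
  Finset.univ.filter fun x => (dom x : ℕ) ≠ 0

/-- The probability of an edge between `x` and `x'`. -/
def pairProb {r m n : ℕ} (ρ α β γ : ℝ) (x x' : Node r m n) : ℝ :=
  if cls x = cls x' then (if dom x = dom x' then ρ else α)
  else (if dom x = dom x' then β else γ)

theorem pairProb_comm {r m n : ℕ} (ρ α β γ : ℝ) (x x' : Node r m n) :
    pairProb ρ α β γ x x' = pairProb ρ α β γ x' x := by
  simp only [pairProb, eq_comm]

/-- The edge probability as a function of the unordered pair of end points. -/
def edgeProb {r m n : ℕ} (ρ α β γ : ℝ) : Sym2 (Node r m n) → ℝ :=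
  Sym2.lift ⟨pairProb ρ α β γ, pairProb_comm ρ α β γ⟩

/-- An undirected unweighted graph on the nodes: it says for every unordered pair `{x, x'}`
(`x = x'` is allowed) whether it is an edge. -/
abbrev Graph (r m n : ℕ) : Type := Sym2 (Node r m n) → Bool

/-- The Bernoulli law with success probability `p ∈ [0, 1]`. -/
noncomputable def bernoulliLaw (p : ℝ) : MeasureTheory.Measure Bool :=
  ENNReal.ofReal p • MeasureTheory.Measure.dirac true +
    ENNReal.ofReal (1 - p) • MeasureTheory.Measure.dirac false

/-- The law of the random graph: the edges are independent Bernoulli variables. -/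
noncomputable def graphLaw (r m n : ℕ) (ρ α β γ : ℝ) : MeasureTheory.Measure (Graph r m n) :=
  MeasureTheory.Measure.pi fun e => bernoulliLaw (edgeProb ρ α β γ e)

/-- The adjacency matrix. -/
def adj {r m n : ℕ} (g : Graph r m n) : Matrix (Node r m n) (Node r m n) ℝ :=
  Matrix.of fun x x' => if g s(x, x') then 1 else 0

/-- The probability of the positive pair `(x, x')`: positive pairs are uniform random edges. -/
noncomputable def posPair {r m n : ℕ} (g : Graph r m n) (x x' : Node r m n) : ℝ :=
  adj g x x' / ∑ z, ∑ z', adj g z z'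

/-- The population spectral contrastive loss of a feature map `f` into `ℝ^k`; negative pairs are
two independent uniform random nodes. -/
noncomputable def contrastiveLoss {r m n k : ℕ} (g : Graph r m n)
    (f : Node r m n → Fin k → ℝ) : ℝ :=
  -2 * ∑ x, ∑ x', posPair g x x' * (f x ⬝ᵥ f x') +
    ∑ x, ∑ x', 1 / (Fintype.card (Node r m n) : ℝ) ^ 2 * (f x ⬝ᵥ f x') ^ 2

/-- `f` is learned by pre-training on `g`: it minimizes the spectral contrastive loss. -/
def IsPretrained {r m n k : ℕ} (g : Graph r m n) (f : Node r m n → Fin k → ℝ) : Prop :=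
  ∀ f' : Node r m n → Fin k → ℝ, contrastiveLoss g f ≤ contrastiveLoss g f'

/-- The mean-zero one-hot embedding `e_{y_x} - (1/r) 𝟙` of the class of `x`. -/
noncomputable def label {r m n : ℕ} (x : Node r m n) : Fin r → ℝ :=
  fun i => (if i = cls x then 1 else 0) - 1 / (r : ℝ)

/-- The scores `bᵀ f(x)` of a linear head `b` on the features `f`. -/
def score {r m n k : ℕ} (f : Node r m n → Fin k → ℝ) (b : Matrix (Fin k) (Fin r) ℝ)
    (x : Node r m n) : Fin r → ℝ :=
  Matrix.mulVec b.transpose (f x)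

/-- The squared loss on the source data with ridge regularization of strength `η`. -/
noncomputable def headLoss {r m n k : ℕ} (η : ℝ) (f : Node r m n → Fin k → ℝ)
    (b : Matrix (Fin k) (Fin r) ℝ) : ℝ :=
  ∑ x ∈ source r m n, (∑ i, (score f b x i - label x i) ^ 2 + η * ∑ j, ∑ i, b j i ^ 2)

/-- `b` is the linear head learned on the source data. -/
def IsHead {r m n k : ℕ} (η : ℝ) (f : Node r m n → Fin k → ℝ)
    (b : Matrix (Fin k) (Fin r) ℝ) : Prop :=
  ∀ b' : Matrix (Fin k) (Fin r) ℝ, headLoss η f b ≤ headLoss η f b'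

/-- `pred` predicts a class of maximal score (with an arbitrary choice among ties). -/
def IsPredictor {r m n k : ℕ} (f : Node r m n → Fin k → ℝ) (b : Matrix (Fin k) (Fin r) ℝ)
    (pred : Node r m n → Fin r) : Prop :=
  ∀ x i, score f b x i ≤ score f b x (pred x)

/-- The 0-1 error of a predictor under the uniform distribution on the target data. -/
noncomputable def targetError {r m n : ℕ} (pred : Node r m n → Fin r) : ℝ :=
  (((target r m n).filter fun x => pred x ≠ cls x).card : ℝ) / ((target r m n).card : ℝ)

end SBM

section Auxiliary

open Matrix
open scoped Kronecker

/-! Averaged over the randomness, the adjacency matrix is constant on blocks, and its eigenspaces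
are the constants, the class contrasts, the domain contrasts and the interactions of class and
domain. The first three have total dimension `r + m - 1 = k`. The interaction eigenvalue lies below
the class and domain eigenvalues by `n * m * (α - γ)` and `n * r * (β - γ)`, so these three form the
best rank-`k` positive semidefinite approximation, with a spectral gap of at least `n * δ`.

Completing the square turns the contrastive loss into the Frobenius distance from a multiple of the
Gram matrix of the features to the sampled adjacency matrix (`IsPretrained.best_approx`).
Hoeffding's inequality and a net argument bound the noise in operator norm by a multiple of `√N`,
where `N = r * m * n` (`measure_noise_quadForm`). A quadratic growth form of the Eckart-Young
theorem converts the gap into stability: the Gram matrix is Frobenius-close to a multiple of the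
signal part (`frobSq_sub_le_of_best_approx`, `frobSq_gram_sub_le`). No eigenvector perturbation
theory is needed.

The ridge head sees the features only through their Gram matrix. The signal part has no interaction
component, so it carries the centred source labels to the same multiple of the labels in every
domain (`specMat_mul_source_label`). Ridge regression with that kernel would thus output exactly `ξ`
times the labels, with `ξ` the `shrinkage` factor, and `frobSq_ridge_sub_le` controls the effect of
the kernel error. Finally, each misclassified node costs at least `1 / 8` of squared error, because
`ξ ≥ 1 / 2`.

Everything after the noise bound is deterministic, so the conclusion holds simultaneously for all
minimizers, heads and tie-breaking rules. -/

/-- The squared Frobenius norm of a real matrix. -/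
def frobSq {ι κ : Type*} [Fintype ι] [Fintype κ] (X : Matrix ι κ ℝ) : ℝ :=
  ∑ i, ∑ j, X i j ^ 2

/-! ### Frobenius norms and stability of best low-rank approximation. -/

section Frobenius

variable {ι κ μ : Type*} [Fintype ι] [Fintype κ] [Fintype μ]

theorem frobSq_nonneg (X : Matrix ι κ ℝ) : 0 ≤ frobSq X :=
  Finset.sum_nonneg fun _ _ => Finset.sum_nonneg fun _ _ => sq_nonneg _

theorem frobSq_eq_trace (X : Matrix ι κ ℝ) : frobSq X = trace (Xᵀ * X) := by
  simp only [frobSq, trace, diag, mul_apply, transpose_apply]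
  rw [Finset.sum_comm]
  exact Finset.sum_congr rfl fun _ _ => Finset.sum_congr rfl fun _ _ => by ring

theorem frobSq_eq_trace' (X : Matrix ι κ ℝ) : frobSq X = trace (X * Xᵀ) := by
  rw [frobSq_eq_trace, trace_mul_comm]

theorem frobSq_smul (c : ℝ) (X : Matrix ι κ ℝ) : frobSq (c • X) = c ^ 2 * frobSq X := by
  simp only [frobSq, Matrix.smul_apply, smul_eq_mul, mul_pow, Finset.mul_sum]

theorem frobSq_neg (X : Matrix ι κ ℝ) : frobSq (-X) = frobSq X := by
  simp [frobSq]

theorem frobSq_add_le (X Y : Matrix ι κ ℝ) : frobSq (X + Y) ≤ 2 * frobSq X + 2 * frobSq Y := by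
  simp only [frobSq, Finset.mul_sum, ← Finset.sum_add_distrib, Matrix.add_apply]
  exact Finset.sum_le_sum fun i _ => Finset.sum_le_sum fun j _ => by
    nlinarith [sq_nonneg (X i j - Y i j)]

theorem frobSq_sub (X Y : Matrix ι κ ℝ) :
    frobSq (X - Y) = frobSq X - 2 * trace (Xᵀ * Y) + frobSq Y := by
  have h : trace (Xᵀ * Y) = ∑ i, ∑ j, X i j * Y i j := by
    simp only [trace, diag, mul_apply, transpose_apply]
    exact Finset.sum_comm
  rw [h]
  simp only [frobSq, Finset.mul_sum, ← Finset.sum_add_distrib, ← Finset.sum_sub_distrib, Matrix.sub_apply]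
  exact Finset.sum_congr rfl fun _ _ => Finset.sum_congr rfl fun _ _ => by ring

theorem frobSq_mul_le (X : Matrix ι κ ℝ) (Y : Matrix κ μ ℝ) :
    frobSq (X * Y) ≤ frobSq X * frobSq Y := by
  have h : frobSq X * frobSq Y = ∑ i, ∑ l, (∑ j, X i j ^ 2) * ∑ j, Y j l ^ 2 := by
    simp only [frobSq]
    rw [Finset.sum_mul]
    refine Finset.sum_congr rfl fun i _ => ?_
    rw [← Finset.mul_sum, Finset.sum_comm]
  rw [h]
  refine Finset.sum_le_sum fun i _ => Finset.sum_le_sum fun l _ => ?_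
  rw [mul_apply]
  exact Finset.sum_mul_sq_le_sq_mul_sq _ _ _

theorem trace_transpose_mul_sq_le (X Y : Matrix ι κ ℝ) :
    trace (Xᵀ * Y) ^ 2 ≤ frobSq X * frobSq Y := by
  have h : trace (Xᵀ * Y) = ∑ p : ι × κ, X p.1 p.2 * Y p.1 p.2 := by
    rw [Fintype.sum_prod_type]
    simp only [trace, diag, mul_apply, transpose_apply]
    exact Finset.sum_comm
  have e (Z : Matrix ι κ ℝ) : frobSq Z = ∑ p : ι × κ, Z p.1 p.2 ^ 2 := by
    rw [Fintype.sum_prod_type]; rfl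
  rw [h, e, e]
  exact Finset.sum_mul_sq_le_sq_mul_sq _ _ _

theorem quadForm_diag (U Z : Matrix ι ι ℝ) (i : ι) :
    (Uᵀ * Z * U) i i = (fun j => U j i) ⬝ᵥ (Z *ᵥ fun j => U j i) := by
  rw [Matrix.mul_assoc, mul_apply]
  rfl

theorem rank_sub_le (X Y : Matrix ι ι ℝ) : (X - Y).rank ≤ X.rank + Y.rank := by
  have : LinearMap.range (X - Y).mulVecLin ≤
      LinearMap.range X.mulVecLin ⊔ LinearMap.range Y.mulVecLin := by
    rintro _ ⟨v, rfl⟩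
    simp only [mulVecLin_apply, sub_mulVec]
    exact Submodule.sub_mem _ (Submodule.mem_sup_left ⟨v, rfl⟩) (Submodule.mem_sup_right ⟨v, rfl⟩)
  exact (Submodule.finrank_mono this).trans (Submodule.finrank_add_le_finrank_add_finrank _ _)

variable [DecidableEq ι]

theorem frobSq_mul_orthogonal (X : Matrix κ ι ℝ) (U : Matrix ι ι ℝ) (h : U * Uᵀ = 1) :
    frobSq (X * U) = frobSq X := by
  rw [frobSq_eq_trace', frobSq_eq_trace', transpose_mul, Matrix.mul_assoc, ← Matrix.mul_assoc U, h,
    Matrix.one_mul]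

/-- The spectral theorem for real symmetric matrices. -/
theorem exists_diagonalization (X : Matrix ι ι ℝ) (hX : X.IsSymm) :
    ∃ (U : Matrix ι ι ℝ) (d : ι → ℝ), Uᵀ * U = 1 ∧ U * Uᵀ = 1 ∧ X = U * diagonal d * Uᵀ ∧
      (Finset.univ.filter fun i => d i ≠ 0).card = X.rank := by
  have hH : X.IsHermitian := by
    rw [Matrix.IsHermitian, conjTranspose_eq_transpose_of_trivial]; exact hX
  have h1 := Unitary.coe_star_mul_self hH.eigenvectorUnitary
  have h2 := Unitary.coe_mul_star_self hH.eigenvectorUnitary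
  have hs := hH.spectral_theorem
  rw [Unitary.conjStarAlgAut_apply] at hs
  simp only [star_eq_conjTranspose, conjTranspose_eq_transpose_of_trivial] at h1 h2 hs
  refine ⟨hH.eigenvectorUnitary, hH.eigenvalues, h1, h2, hs, ?_⟩
  rw [hH.rank_eq_card_non_zero_eigs, Fintype.card_subtype]

theorem sum_sq_col_orthogonal {U : Matrix ι ι ℝ} (h : Uᵀ * U = 1) (i : ι) :
    (fun j => U j i) ⬝ᵥ (fun j => U j i) = 1 := by
  have := congrFun (congrFun h i) i
  rwa [mul_apply, one_apply_eq] at this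

/-- The trace pairing of a symmetric low-rank matrix with a matrix of small numerical radius. -/
theorem trace_mul_sq_le {X Z : Matrix ι ι ℝ} (hX : X.IsSymm) {d : ℕ} (hd : X.rank ≤ d) {τ : ℝ}
    (hZ : ∀ v : ι → ℝ, |v ⬝ᵥ (Z *ᵥ v)| ≤ τ * (v ⬝ᵥ v)) :
    trace (X * Z) ^ 2 ≤ d * τ ^ 2 * frobSq X := by
  obtain ⟨U, e, h1, h2, h3, h4⟩ := exists_diagonalization X hX
  have hfr : frobSq X = ∑ i, e i ^ 2 := by
    rw [h3, frobSq_mul_orthogonal _ _ (by rw [transpose_transpose, h1]), frobSq_eq_trace,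
      transpose_mul, Matrix.mul_assoc, ← Matrix.mul_assoc Uᵀ, h1, Matrix.one_mul, diagonal_transpose,
      diagonal_mul_diagonal, trace_diagonal]
    exact Finset.sum_congr rfl fun _ _ => by ring
  -- In an eigenbasis of `X` only the at most `d` nonzero eigenvalues contribute, each paired with a
  -- diagonal entry of `Z` of size at most `τ`; Cauchy-Schwarz then yields the factor `d`.
  have htr : trace (X * Z) = ∑ i ∈ Finset.univ.filter (fun i => e i ≠ 0),
      e i * (Uᵀ * Z * U) i i := by
    rw [Finset.sum_filter_of_ne (fun i _ h => by rintro h'; simp [h'] at h), h3, Matrix.mul_assoc,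
      Matrix.mul_assoc, trace_mul_comm, Matrix.mul_assoc]
    simp [trace, diagonal_mul]
  rw [htr, hfr]
  refine (Finset.sum_mul_sq_le_sq_mul_sq _ _ _).trans ?_
  rw [mul_comm]
  refine mul_le_mul ?_ (Finset.sum_le_sum_of_subset_of_nonneg (Finset.filter_subset _ _)
    fun _ _ _ => sq_nonneg _) (Finset.sum_nonneg fun _ _ => sq_nonneg _) (by positivity)
  calc ∑ i ∈ Finset.univ.filter (fun i => e i ≠ 0), (Uᵀ * Z * U) i i ^ 2
      ≤ ∑ i ∈ Finset.univ.filter (fun i => e i ≠ 0), τ ^ 2 := by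
        refine Finset.sum_le_sum fun i _ => ?_
        have := hZ fun j => U j i
        rw [← quadForm_diag, sum_sq_col_orthogonal h1, mul_one] at this
        rw [← sq_abs]
        gcongr
    _ = X.rank * τ ^ 2 := by rw [Finset.sum_const, h4, nsmul_eq_mul]
    _ ≤ d * τ ^ 2 := by gcongr

/-- A positive semidefinite matrix of rank at most `k` is the Gram matrix of vectors in `ℝ^k`. -/
theorem exists_gram_factor {B : Matrix ι ι ℝ} (hB : B.IsSymm)
    (hpos : ∀ v : ι → ℝ, 0 ≤ v ⬝ᵥ (B *ᵥ v)) {k : ℕ} (hk : B.rank ≤ k) :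
    ∃ V : Matrix ι (Fin k) ℝ, V * Vᵀ = B := by
  obtain ⟨U, e, h1, h2, h3, h4⟩ := exists_diagonalization B hB
  have he i : 0 ≤ e i := by
    have h := hpos fun j => U j i
    rw [← quadForm_diag, h3] at h
    have : Uᵀ * (U * diagonal e * Uᵀ) * U = diagonal e := by
      rw [Matrix.mul_assoc U, ← Matrix.mul_assoc Uᵀ, h1, Matrix.one_mul, Matrix.mul_assoc, h1,
        Matrix.mul_one]
    rwa [this, diagonal_apply_eq] at h
  let s := Finset.univ.filter fun i => e i ≠ 0
  obtain ⟨φ⟩ : Nonempty (s ↪ Fin k) := by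
    apply Function.Embedding.nonempty_of_card_le
    rw [Fintype.card_coe, h4, Fintype.card_fin]
    exact hk
  -- Column `φ j` is the eigenvector of `j` scaled by `√(e j)`; columns outside the range of `φ` are
  -- zero, which absorbs a rank smaller than `k`.
  let W : Matrix ι (Fin k) ℝ := of fun i c => ∑ j : s, if φ j = c then √(e j) * U i j else 0
  refine ⟨W, ?_⟩
  ext x y
  have hB' : B x y = ∑ j ∈ s, e j * U x j * U y j := by
    rw [Finset.sum_filter_of_ne (fun i _ h => by rintro h'; simp [h'] at h), h3, mul_apply]
    refine Finset.sum_congr rfl fun j _ => ?_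
    rw [mul_diagonal, transpose_apply]; ring
  rw [hB', mul_apply, ← Finset.sum_coe_sort s]
  simp only [transpose_apply, W, of_apply]
  have : ∀ c, (∑ j : s, if φ j = c then √(e j) * U x j else 0) *
      (∑ j : s, if φ j = c then √(e j) * U y j else 0) =
      ∑ j : s, if φ j = c then e j * U x j * U y j else 0 := by
    intro c
    by_cases hc : ∃ j, φ j = c
    · obtain ⟨j, rfl⟩ := hc
      simp only [φ.injective.eq_iff, Finset.sum_ite_eq', Finset.mem_univ, if_true]
      linear_combination (U x j * U y j) * Real.mul_self_sqrt (he j)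
    · push Not at hc
      simp [hc]
  simp only [this]
  rw [Finset.sum_comm]
  simp

/-- Quadratic growth in the Eckart-Young theorem: a matrix of rank at most `k` that leaks out of
the range of the rank-`k` projection `P` is far from a matrix `B` that is large on that range. -/
theorem two_mul_trace_compl_le_frobSq_sub {H B P : Matrix ι ι ℝ} (hH : H.IsSymm) {k : ℕ}
    (hk : H.rank ≤ k) (hP : P.IsSymm) (hPP : P * P = P) (htr : trace P = k)
    (hBP : B * P = B) (hPB : P * B = B) {b : ℝ}
    (hb : ∀ v : ι → ℝ, b ^ 2 * (v ⬝ᵥ (P *ᵥ v)) ≤ (B *ᵥ v) ⬝ᵥ (B *ᵥ v)) :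
    2 * b * trace ((1 - P) * H) ≤ frobSq (H - B) := by
  obtain ⟨U, e, h1, h2, h3, h4⟩ := exists_diagonalization H hH
  set R := 1 - P with hR
  have hRs : Rᵀ = R := by rw [hR, transpose_sub, transpose_one, hP]
  have hRR : R * R = R := by
    rw [hR, Matrix.mul_sub, Matrix.sub_mul, Matrix.sub_mul, hPP]; simp
  have hRB : R * B = 0 := by rw [hR, Matrix.sub_mul, hPB, Matrix.one_mul, sub_self]
  have hBR : B * R = 0 := by rw [hR, Matrix.mul_sub, hBP, Matrix.mul_one, sub_self]
  have htrR : trace R = Fintype.card ι - k := by rw [hR, trace_sub, trace_one, htr]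
  -- Filling the complement of `P` with `b • R` leaves no small singular values. The cross term of
  -- the expansion is the leak of `H`, since `R * B = 0`.
  have hexp : frobSq (H - B - b • R) =
      frobSq (H - B) - 2 * b * trace (R * H) + b ^ 2 * (Fintype.card ι - k) := by
    rw [frobSq_sub, frobSq_smul, frobSq_eq_trace R, hRs, hRR, htrR, transpose_sub, Matrix.mul_smul,
      trace_smul, Matrix.sub_mul, trace_sub, hH, ← transpose_transpose (Bᵀ * R), transpose_mul,
      transpose_transpose, hRs, hRB, trace_mul_comm H R]
    simp
    ring
  have hlow : b ^ 2 * (Fintype.card ι - k) ≤ frobSq (H - B - b • R) := by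
    rw [← frobSq_mul_orthogonal _ U h2]
    have hcols : frobSq ((H - B - b • R) * U) =
        ∑ j, ((H - B - b • R) *ᵥ fun i => U i j) ⬝ᵥ ((H - B - b • R) *ᵥ fun i => U i j) := by
      rw [frobSq, Finset.sum_comm]
      exact Finset.sum_congr rfl fun j _ => Finset.sum_congr rfl fun i _ => by rw [sq]; rfl
    -- On the kernel of `H`, of dimension at least `card ι - k`, only `B + b • R` acts, and it
    -- expands every vector by at least `b`.
    have hker : ∀ j, e j = 0 → b ^ 2 ≤
        ((H - B - b • R) *ᵥ fun i => U i j) ⬝ᵥ ((H - B - b • R) *ᵥ fun i => U i j) := by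
      intro j hj
      set v : ι → ℝ := fun i => U i j with hv
      have hHv : H *ᵥ v = 0 := by
        have : H * U = U * diagonal e := by rw [h3, Matrix.mul_assoc, h1, Matrix.mul_one]
        ext i
        have := congrFun (congrFun this i) j
        rw [mul_diagonal, hj, mul_zero] at this
        exact this
      have hvv : v ⬝ᵥ v = 1 := sum_sq_col_orthogonal h1 j
      have hBR' : (B *ᵥ v) ⬝ᵥ (R *ᵥ v) = 0 := by
        rw [← hRs, mulVec_transpose, dotProduct_comm, ← dotProduct_mulVec, mulVec_mulVec, hRB,
          zero_mulVec, dotProduct_zero]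
      have hRv : (R *ᵥ v) ⬝ᵥ (R *ᵥ v) = 1 - v ⬝ᵥ (P *ᵥ v) := by
        rw [dotProduct_mulVec, ← mulVec_transpose, hRs, mulVec_mulVec, hRR, dotProduct_comm, hR, sub_mulVec, one_mulVec, dotProduct_sub, hvv]
      have := hb v
      rw [sub_mulVec, sub_mulVec, hHv, smul_mulVec]
      simp only [zero_sub, dotProduct_sub, sub_dotProduct, neg_dotProduct, dotProduct_neg,
        smul_dotProduct, dotProduct_smul, smul_eq_mul, hRv, hBR', dotProduct_comm (R *ᵥ v) (B *ᵥ v)]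
      nlinarith
    rw [hcols]
    have hcount : (Fintype.card ι : ℝ) - k ≤ (Finset.univ.filter fun j => e j = 0).card := by
      have := Finset.card_filter_add_card_filter_not (s := (Finset.univ : Finset ι)) (fun j => e j = 0)
      rw [Finset.card_univ] at this
      have h5 : (Finset.univ.filter fun i => ¬ e i = 0).card ≤ k := h4.trans_le hk
      have : Fintype.card ι ≤ (Finset.univ.filter fun j => e j = 0).card + k := by omega
      rw [sub_le_iff_le_add]
      exact_mod_cast this
    calc b ^ 2 * (Fintype.card ι - k)
        ≤ ∑ j ∈ Finset.univ.filter (fun j => e j = 0), b ^ 2 := by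
          rw [Finset.sum_const, nsmul_eq_mul, mul_comm]
          gcongr
      _ ≤ ∑ j ∈ Finset.univ.filter (fun j => e j = 0),
          ((H - B - b • R) *ᵥ fun i => U i j) ⬝ᵥ ((H - B - b • R) *ᵥ fun i => U i j) :=
          Finset.sum_le_sum fun j hj => hker j (Finset.mem_filter.1 hj).2
      _ ≤ _ := Finset.sum_le_sum_of_subset_of_nonneg (Finset.filter_subset _ _)
          fun j _ _ => by
            rw [dotProduct]
            exact Finset.sum_nonneg fun i _ => mul_self_nonneg _
  linarith

/-- A symmetric idempotent matrix has rank equal to its trace. -/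
theorem rank_eq_trace_of_idempotent {P : Matrix ι ι ℝ} (hP : P.IsSymm) (hPP : P * P = P) :
    (P.rank : ℝ) = trace P := by
  obtain ⟨U, e, h1, h2, h3, h4⟩ := exists_diagonalization P hP
  have hd : Uᵀ * P * U = diagonal e := by
    rw [h3, Matrix.mul_assoc U, ← Matrix.mul_assoc Uᵀ, h1, Matrix.one_mul, Matrix.mul_assoc, h1,
        Matrix.mul_one]
  have he i : e i * e i = e i := by
    have : diagonal e * diagonal e = diagonal e := by
      rw [← hd]
      calc Uᵀ * P * U * (Uᵀ * P * U) = Uᵀ * P * (U * Uᵀ) * P * U := by noncomm_ring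
        _ = Uᵀ * (P * P) * U := by rw [h2]; noncomm_ring
        _ = _ := by rw [hPP]
    rw [diagonal_mul_diagonal] at this
    exact congrFun (diagonal_injective this) i
  have : trace P = ∑ i, e i := by
    rw [h3, trace_mul_comm, ← Matrix.mul_assoc, h1, Matrix.one_mul, trace_diagonal]
  rw [this, ← h4, Finset.card_filter]
  push_cast
  refine Finset.sum_congr rfl fun i _ => ?_
  by_cases h : e i = 0
  · simp [h]
  · rw [if_pos h]; exact (mul_right_cancel₀ h (by rw [he, one_mul])).symm

/-- Perturbation bound for a best rank-`k` approximation `H` of `A = B + Q + Z`. -/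
theorem frobSq_sub_le_of_best_approx {H A B Q Z P : Matrix ι ι ℝ} (hH : H.IsSymm) {k : ℕ}
    (hk : H.rank ≤ k) (hB : B.IsSymm) (hkB : B.rank ≤ k)
    (hP : P.IsSymm) (hPP : P * P = P) (htr : trace P = k)
    (hBP : B * P = B) (hPB : P * B = B) {a b τ : ℝ} (ha : 0 ≤ a) (hab : a < b)
    (hb : ∀ v : ι → ℝ, b ^ 2 * (v ⬝ᵥ (P *ᵥ v)) ≤ (B *ᵥ v) ⬝ᵥ (B *ᵥ v))
    (hA : A = B + Q + Z) (hBQ : trace (B * Q) = 0)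
    (hHQ : trace (H * Q) ≤ a * trace ((1 - P) * H))
    (hZ : ∀ v : ι → ℝ, |v ⬝ᵥ (Z *ᵥ v)| ≤ τ * (v ⬝ᵥ v))
    (hopt : frobSq (H - A) ≤ frobSq (B - A)) :
    (b - a) ^ 2 * frobSq (H - B) ≤ 8 * k * τ ^ 2 * b ^ 2 := by
  have hg := two_mul_trace_compl_le_frobSq_sub hH hk hP hPP htr hBP hPB hb
  have hsym : (H - B).IsSymm := hH.sub hB
  have hrank : (H - B).rank ≤ 2 * k := (rank_sub_le H B).trans (by omega)
  have ht := trace_mul_sq_le hsym hrank hZ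
  have e1 : frobSq (H - A) = frobSq (H - B) - 2 * trace ((H - B) * (Q + Z)) + frobSq (Q + Z) := by
    rw [show H - A = (H - B) - (Q + Z) by rw [hA]; abel, frobSq_sub, hsym]
  have e2 : frobSq (B - A) = frobSq (Q + Z) := by
    rw [show B - A = -(Q + Z) by rw [hA]; abel, frobSq_neg]
  have e3 : trace ((H - B) * (Q + Z)) = trace (H * Q) + trace ((H - B) * Z) := by
    rw [Matrix.mul_add, trace_add, Matrix.sub_mul, trace_sub, hBQ, sub_zero]
  rw [e1, e2, e3] at hopt
  set x := frobSq (H - B)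
  set y := trace ((H - B) * Z)
  have hx : 0 ≤ x := frobSq_nonneg _
  have hb0 : 0 < b := ha.trans_lt hab
  -- Optimality gives `x ≤ 2 * trace (H * Q) + 2 * y`, and quadratic growth absorbs the first term,
  -- since `2 * b * trace (H * Q) ≤ a * x`.
  have h1 : (b - a) * x ≤ 2 * b * y := by nlinarith
  have h2 : ((b - a) * x) ^ 2 ≤ (2 * b * y) ^ 2 :=
    pow_le_pow_left₀ (mul_nonneg (by linarith) hx) h1 2
  push_cast at ht
  rcases hx.eq_or_lt with h0 | h0
  · rw [← h0]; simp; positivity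
  · have h3 : ((b - a) ^ 2 * x) * x ≤ (8 * k * τ ^ 2 * b ^ 2) * x := by
      nlinarith [mul_le_mul_of_nonneg_left ht (by positivity : 0 ≤ 4 * b ^ 2)]
    exact le_of_mul_le_mul_right h3 h0

end Frobenius

/-! ### Sub-Gaussian tails for bilinear forms of the noise. -/

section Concentration

open MeasureTheory ProbabilityTheory

/-- The signed indicator of a Boolean minus `p`. -/
noncomputable def centered (p : ℝ) (b : Bool) : ℝ := (if b then 1 else 0) - p

theorem isProbabilityMeasure_bernoulliLaw {p : ℝ} (h0 : 0 ≤ p) (h1 : p ≤ 1) :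
    IsProbabilityMeasure (SBM.bernoulliLaw p) := by
  constructor
  simp only [SBM.bernoulliLaw, Measure.add_apply, Measure.smul_apply, measure_univ, smul_eq_mul,
    mul_one]
  rw [← ENNReal.ofReal_add h0 (by linarith)]
  simp

theorem hasSubgaussianMGF_centered {p : ℝ} (h0 : 0 ≤ p) (h1 : p ≤ 1) :
    HasSubgaussianMGF (centered p) (1 / 4) (SBM.bernoulliLaw p) := by
  have := isProbabilityMeasure_bernoulliLaw h0 h1
  have hint : ∫ b, (if b then (1 : ℝ) else 0) ∂(SBM.bernoulliLaw p) = p := by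
    rw [integral_fintype (Integrable.of_finite)]
    simp [Measure.real, SBM.bernoulliLaw, h0]
  have := hasSubgaussianMGF_of_mem_Icc (μ := SBM.bernoulliLaw p)
    (X := fun b : Bool => if b then (1 : ℝ) else 0) (a := 0) (b := 1)
    (Measurable.of_discrete).aemeasurable
    (Filter.Eventually.of_forall fun b => by cases b <;> simp)
  rw [hint] at this
  have h4 : ((‖(1 : ℝ) - 0‖₊ / 2) ^ 2 : NNReal) = 1 / 4 := by
    rw [sub_zero, nnnorm_one]; norm_num
  rw [h4] at this
  exact this

variable {ι : Type*} [Fintype ι]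

/-- Hoeffding's inequality for a weighted sum of centered Bernoulli coordinates. -/
theorem measure_weighted_sum_ge_le (p : ι → ℝ) (hp : ∀ e, 0 ≤ p e ∧ p e ≤ 1) (c : ι → ℝ)
    (hc : ∑ e, c e ^ 2 ≤ 2) {s : ℝ} (hs : 0 ≤ s) :
    (Measure.pi fun e => SBM.bernoulliLaw (p e)).real
      {g | s ≤ ∑ e, c e * centered (p e) (g e)} ≤ Real.exp (-s ^ 2) := by
  have : ∀ e, IsProbabilityMeasure (SBM.bernoulliLaw (p e)) := fun e =>
    isProbabilityMeasure_bernoulliLaw (hp e).1 (hp e).2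
  have hind := iIndepFun_pi (μ := fun e => SBM.bernoulliLaw (p e))
    (X := fun e b => c e * centered (p e) b) fun e => (Measurable.of_discrete).aemeasurable
  have hsub (e : ι) : HasSubgaussianMGF (fun g : ι → Bool => c e * centered (p e) (g e))
      (Real.toNNReal (c e ^ 2) * (1 / 4)) (Measure.pi fun e => SBM.bernoulliLaw (p e)) := by
    have h := (hasSubgaussianMGF_centered (hp e).1 (hp e).2).const_mul (c e)
    rw [← (measurePreserving_eval (fun e => SBM.bernoulliLaw (p e)) e).map_eq] at h
    rw [Real.toNNReal_of_nonneg (sq_nonneg _)]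
    exact HasSubgaussianMGF.of_map (X := fun b => c e * centered (p e) b)
      (measurable_pi_apply e).aemeasurable h
  have hsum := HasSubgaussianMGF.sum_of_iIndepFun hind (s := Finset.univ) fun e _ => hsub e
  -- The parameters `c e ^ 2 / 4` add up to at most `1 / 2`, for which the tail `exp (-s ^ 2 / (2 *
  -- (1 / 2)))` is `exp (-s ^ 2)`.
  have hsum' : HasSubgaussianMGF (fun g : ι → Bool => ∑ e, c e * centered (p e) (g e)) (1 / 2)
      (Measure.pi fun e => SBM.bernoulliLaw (p e)) := by
    refine ⟨hsum.integrable_exp_mul, fun t => (hsum.mgf_le t).trans ?_⟩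
    refine Real.exp_le_exp.2 ?_
    gcongr
    rw [← Finset.sum_mul, ← NNReal.coe_le_coe]
    push_cast
    simp only [Real.coe_toNNReal _ (sq_nonneg _)]
    linarith
  refine (hsum'.measure_ge_le hs).trans_eq ?_
  congr 1
  norm_num

variable [DecidableEq ι]

theorem card_fiber_sym2_le (e : Sym2 ι) :
    (Finset.univ.filter fun q : ι × ι => s(q.1, q.2) = e).card ≤ 2 := by
  induction e with
  | h a b =>
    refine (Finset.card_le_card (t := {(a, b), (b, a)}) ?_).trans Finset.card_le_two
    intro q hq
    simp only [Finset.mem_filter, Finset.mem_univ, true_and, Sym2.eq_iff] at hq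
    simp only [Finset.mem_insert, Finset.mem_singleton, Prod.ext_iff]
    exact hq

/-- The centered adjacency matrix of a random graph with edge probabilities `p`. -/
noncomputable def noise (p : Sym2 ι → ℝ) (g : Sym2 ι → Bool) : Matrix ι ι ℝ :=
  Matrix.of fun x y => centered (p s(x, y)) (g s(x, y))

/-- The entries of the symmetric noise are not independent, so the form is regrouped over unordered
pairs. Each pair collects at most two terms, which costs a factor 2 in the sum of squared weights.
-/
theorem measure_noise_bilin_ge_le (p : Sym2 ι → ℝ) (hp : ∀ e, 0 ≤ p e ∧ p e ≤ 1)
    (u v : ι → ℝ) (hu : ∑ i, u i ^ 2 ≤ 1) (hv : ∑ i, v i ^ 2 ≤ 1) {s : ℝ} (hs : 0 ≤ s) :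
    (Measure.pi fun e => SBM.bernoulliLaw (p e)).real
      {g | s ≤ u ⬝ᵥ (noise p g *ᵥ v)} ≤ Real.exp (-s ^ 2) := by
  let c : Sym2 ι → ℝ := fun e =>
    ∑ q ∈ Finset.univ.filter (fun q : ι × ι => s(q.1, q.2) = e), u q.1 * v q.2
  have hc : ∑ e, c e ^ 2 ≤ 2 := by
    calc ∑ e, c e ^ 2
        ≤ ∑ e, 2 * ∑ q ∈ Finset.univ.filter (fun q : ι × ι => s(q.1, q.2) = e),
            (u q.1 * v q.2) ^ 2 := by
          refine Finset.sum_le_sum fun e _ => sq_sum_le_card_mul_sum_sq.trans ?_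
          refine mul_le_mul_of_nonneg_right ?_ (Finset.sum_nonneg fun _ _ => sq_nonneg _)
          exact_mod_cast card_fiber_sym2_le e
      _ = 2 * ∑ q : ι × ι, (u q.1 * v q.2) ^ 2 := by
          rw [← Finset.mul_sum, Finset.sum_fiberwise]
      _ = 2 * ((∑ i, u i ^ 2) * ∑ i, v i ^ 2) := by
          rw [Fintype.sum_prod_type, Finset.sum_mul_sum]
          simp only [mul_pow]
      _ ≤ 2 * (1 * 1) := by
          gcongr
      _ = 2 := by norm_num
  have heq (g : Sym2 ι → Bool) :
      u ⬝ᵥ (noise p g *ᵥ v) = ∑ e, c e * centered (p e) (g e) := by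
    have h1 : u ⬝ᵥ (noise p g *ᵥ v) = ∑ q : ι × ι, u q.1 * v q.2 *
        centered (p s(q.1, q.2)) (g s(q.1, q.2)) := by
      rw [Fintype.sum_prod_type]
      simp only [dotProduct, mulVec, noise, of_apply, Finset.mul_sum]
      exact Finset.sum_congr rfl fun _ _ => Finset.sum_congr rfl fun _ _ => by ring
    rw [h1, ← Finset.sum_fiberwise Finset.univ (fun q : ι × ι => s(q.1, q.2))]
    refine Finset.sum_congr rfl fun e _ => ?_
    rw [Finset.sum_mul]
    refine Finset.sum_congr rfl fun q hq => ?_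
    rw [(Finset.mem_filter.1 hq).2]
  simp only [heq]
  exact measure_weighted_sum_ge_le p hp c hc hs

end Concentration

/-! ### Nets of the unit ball and operator norms. -/

section Net

open Metric

/-- The unit ball of a finite-dimensional normed space has a `1/2`-net of size `5 ^ dim`. -/
theorem exists_half_net (E : Type*) [NormedAddCommGroup E] [NormedSpace ℝ E]
    [FiniteDimensional ℝ E] :
    ∃ s : Finset E, s.card ≤ 5 ^ Module.finrank ℝ E ∧ (∀ x ∈ s, ‖x‖ ≤ 1) ∧
      ∀ x : E, ‖x‖ ≤ 1 → ∃ y ∈ s, ‖x - y‖ ≤ 1 / 2 := by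
  classical
  -- A `1/2`-separated set of maximal size is a net. Doubling it gives a 1-separated set in the ball
  -- of radius 2, whose size is at most `5 ^ dim`; hence the maximum exists.
  let good : Finset E → Prop := fun s =>
    (∀ x ∈ s, ‖x‖ ≤ 1) ∧ ∀ x ∈ s, ∀ y ∈ s, x ≠ y → 1 / 2 ≤ ‖x - y‖
  have hcard : ∀ s, good s → s.card ≤ 5 ^ Module.finrank ℝ E := by
    intro s hs
    have hinj : Function.Injective fun x : E => (2 : ℝ) • x := smul_right_injective E two_ne_zero
    rw [← Finset.card_image_of_injective s hinj]
    apply Besicovitch.card_le_of_separated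
    · intro c hc
      obtain ⟨x, hx, rfl⟩ := Finset.mem_image.1 hc
      rw [norm_smul, Real.norm_two]
      linarith [hs.1 x hx]
    · intro c hc d hd hcd
      obtain ⟨x, hx, rfl⟩ := Finset.mem_image.1 hc
      obtain ⟨y, hy, rfl⟩ := Finset.mem_image.1 hd
      rw [← smul_sub, norm_smul, Real.norm_two]
      linarith [hs.2 x hx y hy fun h => hcd (by rw [h])]
  let Q : ℕ → Prop := fun n => ∃ s, good s ∧ s.card = n
  have hQ0 : Q 0 := ⟨∅, ⟨by simp, by simp⟩, rfl⟩
  obtain ⟨s, hs, hsn⟩ := Nat.findGreatest_spec (P := Q) (Nat.zero_le (5 ^ Module.finrank ℝ E)) hQ0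
  refine ⟨s, hcard s hs, hs.1, fun x hx => ?_⟩
  by_contra! hfar
  have hxs : x ∉ s := fun h => by
    have := hfar x h
    rw [sub_self, norm_zero] at this
    linarith
  have hgood : good (insert x s) := by
    refine ⟨fun y hy => ?_, fun y hy z hz hyz => ?_⟩
    · rcases Finset.mem_insert.1 hy with rfl | hy
      exacts [hx, hs.1 y hy]
    · rcases Finset.mem_insert.1 hy with rfl | hy' <;>
        rcases Finset.mem_insert.1 hz with rfl | hz'
      · exact absurd rfl hyz
      · exact (hfar z hz').le
      · rw [norm_sub_rev]; exact (hfar y hy').le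
      · exact hs.2 y hy' z hz' hyz
  have h1 := Nat.le_findGreatest (P := Q) (hcard _ hgood) ⟨_, hgood, rfl⟩
  rw [Finset.card_insert_of_notMem hxs, hsn] at h1
  omega

/-- An operator that is small on a `1/2`-net has small norm. -/
theorem opNorm_le_of_net {E : Type*} [NormedAddCommGroup E] [InnerProductSpace ℝ E]
    {s : Finset E} (hs : ∀ x : E, ‖x‖ ≤ 1 → ∃ y ∈ s, ‖x - y‖ ≤ 1 / 2) (T : E →L[ℝ] E) {M : ℝ}
    (hM : 0 ≤ M) (h : ∀ x ∈ s, ∀ y ∈ s, inner ℝ y (T x) ≤ M) : ‖T‖ ≤ 4 * M := by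
  have hnet : ∀ x ∈ s, ‖T x‖ ≤ 2 * M := by
    intro x hx
    rcases eq_or_ne (T x) 0 with h0 | h0
    · rw [h0, norm_zero]; linarith
    have hpos : 0 < ‖T x‖ := norm_pos_iff.2 h0
    obtain ⟨y, hy, hyd⟩ := hs (‖T x‖⁻¹ • T x) (by
      rw [norm_smul, norm_inv, norm_norm, inv_mul_cancel₀ hpos.ne'])
    have e1 : inner ℝ (‖T x‖⁻¹ • T x) (T x) = ‖T x‖ := by
      rw [real_inner_smul_left, real_inner_self_eq_norm_sq]
      field_simp
    have e2 : inner ℝ (‖T x‖⁻¹ • T x - y) (T x) ≤ 1 / 2 * ‖T x‖ :=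
      (real_inner_le_norm _ _).trans (by gcongr)
    rw [inner_sub_left, e1] at e2
    linarith [h x hx y hy]
  -- The net is used twice: above to test `T x` against net vectors, here to replace `x` by a net
  -- point. The remaining `‖T‖ / 2` is absorbed at the end.
  have hball : ∀ x : E, ‖x‖ ≤ 1 → ‖T x‖ ≤ 2 * M + ‖T‖ / 2 := by
    intro x hx
    obtain ⟨y, hy, hyd⟩ := hs x hx
    calc ‖T x‖ = ‖T y + T (x - y)‖ := by rw [← map_add]; congr 2; abel
      _ ≤ ‖T y‖ + ‖T (x - y)‖ := norm_add_le _ _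
      _ ≤ 2 * M + ‖T‖ * (1 / 2) :=
        add_le_add (hnet y hy) ((T.le_opNorm _).trans (by gcongr))
      _ = _ := by ring
  have : ‖T‖ ≤ 2 * M + ‖T‖ / 2 := by
    refine T.opNorm_le_of_unit_norm (by positivity) fun x hx => hball x hx.le
  linarith

end Net

/-! ### Operator norm of the noise. -/

section NoiseBound

open MeasureTheory

variable {ι : Type*} [Fintype ι] [DecidableEq ι]

/-- With high probability the noise has operator norm of the order of the square root of the
number of nodes. -/
theorem measure_noise_quadForm (p : Sym2 ι → ℝ) (hp : ∀ e, 0 ≤ p e ∧ p e ≤ 1) {ζ : ℝ}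
    (hζ : 0 < ζ) :
    1 - Real.exp (-(ζ * Fintype.card ι)) ≤ (Measure.pi fun e => SBM.bernoulliLaw (p e)).real
      {g | ∀ v : ι → ℝ, |v ⬝ᵥ (noise p g *ᵥ v)| ≤
        4 * √((4 + ζ) * Fintype.card ι) * (v ⬝ᵥ v)} := by
  have : ∀ e, IsProbabilityMeasure (SBM.bernoulliLaw (p e)) := fun e =>
    isProbabilityMeasure_bernoulliLaw (hp e).1 (hp e).2
  set μ := Measure.pi fun e => SBM.bernoulliLaw (p e)
  set N : ℝ := (Fintype.card ι : ℝ)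
  set M : ℝ := √((4 + ζ) * N)
  have hN : 0 ≤ N := Nat.cast_nonneg _
  have hM : 0 ≤ M := Real.sqrt_nonneg _
  have hM2 : M ^ 2 = (4 + ζ) * N := Real.sq_sqrt (by positivity)
  obtain ⟨s, hcard, hs1, hs2⟩ := exists_half_net (EuclideanSpace ℝ ι)
  rw [finrank_euclideanSpace] at hcard
  -- There are at most `5 ^ (2 * N) ≤ exp (4 * N)` pairs of net points. The `4` in `M ^ 2 = (4 + ζ)
  -- * N` pays for this union bound, and `ζ` remains as the failure exponent.
  let bad : Set (Sym2 ι → Bool) := ⋃ q ∈ s ×ˢ s, {g | M ≤ q.2.ofLp ⬝ᵥ (noise p g *ᵥ q.1.ofLp)}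
  have hnorm (x : EuclideanSpace ℝ ι) (hx : x ∈ s) : ∑ i, x.ofLp i ^ 2 ≤ 1 := by
    rw [← EuclideanSpace.real_norm_sq_eq]
    exact pow_le_one₀ (norm_nonneg _) (hs1 x hx)
  have hbad : μ.real bad ≤ Real.exp (-(ζ * N)) := by
    calc μ.real bad ≤ ∑ q ∈ s ×ˢ s, μ.real {g | M ≤ q.2.ofLp ⬝ᵥ (noise p g *ᵥ q.1.ofLp)} :=
          measureReal_biUnion_finset_le _ _
      _ ≤ ∑ q ∈ s ×ˢ s, Real.exp (-M ^ 2) := by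
          refine Finset.sum_le_sum fun q hq => ?_
          obtain ⟨hq1, hq2⟩ := Finset.mem_product.1 hq
          exact measure_noise_bilin_ge_le p hp _ _ (hnorm _ hq2) (hnorm _ hq1) hM
      _ = (s.card : ℝ) ^ 2 * Real.exp (-M ^ 2) := by
          rw [Finset.sum_const, Finset.card_product, nsmul_eq_mul]; push_cast; ring
      _ ≤ (5 ^ Fintype.card ι : ℝ) ^ 2 * Real.exp (-M ^ 2) := by
          gcongr; exact_mod_cast hcard
      _ ≤ Real.exp (4 * N) * Real.exp (-M ^ 2) := by
          gcongr
          have h5 : (5 : ℝ) ≤ Real.exp 2 := by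
            have := Real.add_one_le_exp (1 : ℝ)
            have h6 : Real.exp 2 = Real.exp 1 * Real.exp 1 := by rw [← Real.exp_add]; norm_num
            have := Real.exp_one_gt_d9
            nlinarith
          calc ((5 : ℝ) ^ Fintype.card ι) ^ 2 ≤ (Real.exp 2 ^ Fintype.card ι) ^ 2 := by gcongr
            _ = Real.exp (4 * N) := by
              rw [← pow_mul, ← Real.exp_nat_mul]; congr 1; push_cast; ring
      _ = Real.exp (-(ζ * N)) := by rw [← Real.exp_add, hM2]; congr 1; ring
  have hgood : badᶜ ⊆ {g | ∀ v : ι → ℝ, |v ⬝ᵥ (noise p g *ᵥ v)| ≤ 4 * M * (v ⬝ᵥ v)} := by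
    intro g hg v
    have hg' : ∀ x ∈ s, ∀ y ∈ s, y.ofLp ⬝ᵥ (noise p g *ᵥ x.ofLp) ≤ M := by
      intro x hx y hy
      by_contra! h
      exact hg (Set.mem_biUnion (Finset.mk_mem_product hx hy) h.le)
    have hT := opNorm_le_of_net hs2 (Matrix.toEuclideanCLM (𝕜 := ℝ) (noise p g)) hM (by
      intro x hx y hy
      refine le_trans (le_of_eq ?_) (hg' x hx y hy)
      rw [EuclideanSpace.inner_eq_star_dotProduct, dotProduct_comm]
      simp)
    have h1 := abs_real_inner_le_norm (WithLp.toLp 2 v)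
      (Matrix.toEuclideanCLM (𝕜 := ℝ) (noise p g) (WithLp.toLp 2 v))
    have h2 := (Matrix.toEuclideanCLM (𝕜 := ℝ) (noise p g)).le_opNorm (WithLp.toLp 2 v)
    have h3 : inner ℝ (WithLp.toLp 2 v)
        (Matrix.toEuclideanCLM (𝕜 := ℝ) (noise p g) (WithLp.toLp 2 v)) =
        v ⬝ᵥ (noise p g *ᵥ v) := by
      rw [EuclideanSpace.inner_eq_star_dotProduct, dotProduct_comm]
      simp
    have h4 : ‖(WithLp.toLp 2 v : EuclideanSpace ℝ ι)‖ ^ 2 = v ⬝ᵥ v := by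
      rw [EuclideanSpace.real_norm_sq_eq]
      simp only [dotProduct, sq]
    rw [h3] at h1
    rw [← h4]
    calc |v ⬝ᵥ (noise p g *ᵥ v)| ≤ _ := h1
      _ ≤ ‖WithLp.toLp 2 v‖ * (4 * M * ‖WithLp.toLp 2 v‖) := by
        gcongr
        exact h2.trans (by gcongr)
      _ = _ := by ring
  calc 1 - Real.exp (-(ζ * N)) ≤ 1 - μ.real bad := by linarith
    _ = μ.real badᶜ := (probReal_compl_eq_one_sub (Set.toFinite bad).measurableSet).symm
    _ ≤ _ := measureReal_mono hgood

end NoiseBound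

/-! ### Stability of kernel ridge regression. -/

section RidgeHead

variable {ι κ μ : Type*} [Fintype ι] [Fintype κ] [Fintype μ]

theorem trace_transpose_mul_gram_nonneg (F : Matrix ι κ ℝ) (u : Matrix ι μ ℝ) :
    0 ≤ trace (uᵀ * (F * Fᵀ * u)) := by
  have : uᵀ * (F * Fᵀ * u) = (Fᵀ * u)ᵀ * (Fᵀ * u) := by
    rw [transpose_mul, transpose_transpose]; simp only [Matrix.mul_assoc]
  rw [this, ← frobSq_eq_trace]
  exact frobSq_nonneg _

/-- Perturbation bound for kernel ridge regression: the dual weights `w` solve the regression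
problem of the Gram matrix `F Fᵀ` restricted by the projection `E`, and `E Y` is mapped to a
multiple of `Y` by the reference kernel `K`. -/
theorem frobSq_ridge_sub_le {F : Matrix ι κ ℝ} {K E : Matrix ι ι ℝ} {Y w : Matrix ι μ ℝ}
    {σ θ : ℝ} (hσ : 0 < σ) (hθ : 0 ≤ θ) (hE : E.IsSymm) (hEw : E * w = w) (hEE : E * E = E)
    (hw : σ • w = E * (Y - F * Fᵀ * w)) (hK : K * (E * Y) = θ • Y) :
    frobSq (F * Fᵀ * w - (θ / (θ + σ)) • Y) ≤
      2 / σ ^ 2 * frobSq (E * Y) * frobSq (F * Fᵀ - K) * (1 + frobSq (F * Fᵀ) / σ ^ 2) := by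
  set G := F * Fᵀ with hG
  set t := (θ + σ)⁻¹ with ht
  have hts : 0 < θ + σ := by linarith
  have ht0 : 0 < t := inv_pos.2 hts
  have htσ : t * σ = 1 - t * θ := by rw [ht]; field_simp; ring
  -- `t • (E * Y)` solves the regression problem exactly when the kernel is `K`, so `u` is the error
  -- of the dual weights.
  set u := w - t • (E * Y) with hu
  have hEu : E * u = u := by
    rw [hu, Matrix.mul_sub, Matrix.mul_smul, ← Matrix.mul_assoc, hEE, hEw]
  have hwu : w = u + t • (E * Y) := by rw [hu]; abel
  clear_value t u
  have hYsum : t • (K * (E * Y)) = Y - (t * σ) • Y := by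
    rw [hK, smul_smul, htσ, sub_smul, one_smul]; abel
  have hGw : G * w = G * u + t • (G * (E * Y)) := by rw [hwu, Matrix.mul_add, Matrix.mul_smul]
  have hnormal : σ • u = -(t • (E * ((G - K) * (E * Y)))) - E * (G * u) := by
    have h1 : E * (t • (K * (E * Y))) = E * Y - (t * σ) • (E * Y) := by
      rw [hYsum, Matrix.mul_sub, Matrix.mul_smul]
    rw [Matrix.mul_smul] at h1
    have h2 : σ • (t • (E * Y)) = (t * σ) • (E * Y) := by rw [smul_smul, mul_comm]
    have h3 : σ • u = σ • w - σ • (t • (E * Y)) := by rw [hu, smul_sub]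
    rw [h3, h2, hw, hGw, Matrix.mul_sub, Matrix.mul_add, Matrix.mul_smul, Matrix.sub_mul,
      Matrix.mul_sub, smul_sub, h1]
    abel
  have hutr (X : Matrix ι μ ℝ) : trace (uᵀ * (E * X)) = trace (uᵀ * X) := by
    conv_rhs => rw [← hEu, transpose_mul, hE, Matrix.mul_assoc]
  -- Testing the error equation against `u` leaves a term in the Gram matrix with a favourable sign,
  -- so the ridge `σ` alone controls `u`.
  have henergy : σ * frobSq u = -(t * trace (uᵀ * ((G - K) * (E * Y)))) -
      trace (uᵀ * (G * u)) := by
    rw [← hutr (G * u), ← hutr ((G - K) * (E * Y)), frobSq_eq_trace, ← smul_eq_mul,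
      ← trace_smul, ← Matrix.mul_smul, hnormal]
    simp [Matrix.mul_sub]
  have hgram : 0 ≤ trace (uᵀ * (G * u)) := trace_transpose_mul_gram_nonneg F u
  set W := (G - K) * (E * Y) with hW
  have hWle : frobSq W ≤ frobSq (G - K) * frobSq (E * Y) := frobSq_mul_le _ _
  have hcs := trace_transpose_mul_sq_le u W
  have hu0 := frobSq_nonneg u
  have hu2 : σ ^ 2 * frobSq u ≤ t ^ 2 * frobSq W := by
    have h1 : σ * frobSq u ≤ -(t * trace (uᵀ * W)) := by linarith
    have h2 : (σ * frobSq u) ^ 2 ≤ (t * trace (uᵀ * W)) ^ 2 := by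
      rw [← neg_sq (t * _)]
      exact pow_le_pow_left₀ (by positivity) h1 2
    rcases hu0.eq_or_lt with h0 | h0
    · rw [← h0, mul_zero]
      exact mul_nonneg (sq_nonneg _) (frobSq_nonneg _)
    · have h3 := mul_le_mul_of_nonneg_left hcs (sq_nonneg t)
      exact le_of_mul_le_mul_right (by nlinarith) h0
  have htσ' : t ^ 2 ≤ 1 / σ ^ 2 := by
    rw [ht, inv_pow, ← one_div]
    gcongr
    linarith
  have hdec : G * w - (θ / (θ + σ)) • Y = G * u + t • W := by
    have : (θ / (θ + σ)) • Y = t • (K * (E * Y)) := by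
      rw [hK, smul_smul, ht]; congr 1; field_simp
    rw [this, hGw, hW, Matrix.sub_mul, smul_sub]
    abel
  have hfin : frobSq u ≤ t ^ 2 * frobSq W / σ ^ 2 := by
    rw [le_div_iff₀ (by positivity)]; linarith
  have hG0 := frobSq_nonneg G
  rw [hdec]
  calc frobSq (G * u + t • W) ≤ 2 * frobSq (G * u) + 2 * frobSq (t • W) := frobSq_add_le _ _
    _ ≤ 2 * (frobSq G * (t ^ 2 * frobSq W / σ ^ 2)) + 2 * (t ^ 2 * frobSq W) := by
        rw [frobSq_smul]
        have := (frobSq_mul_le G u).trans (mul_le_mul_of_nonneg_left hfin hG0)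
        linarith
    _ = 2 * t ^ 2 * frobSq W * (1 + frobSq G / σ ^ 2) := by ring
    _ ≤ 2 * (1 / σ ^ 2) * (frobSq (G - K) * frobSq (E * Y)) * (1 + frobSq G / σ ^ 2) := by
        have := frobSq_nonneg W
        gcongr
    _ = _ := by ring

end RidgeHead

/-! ### The learned head in dual form, and counting errors. -/

namespace SBM

variable {r m n k : ℕ}

/-- The features as a matrix with one row per node. -/
def featMat (f : Node r m n → Fin k → ℝ) : Matrix (Node r m n) (Fin k) ℝ := of f

/-- The labels as a matrix with one row per node. -/
noncomputable def labelMat (r m n : ℕ) : Matrix (Node r m n) (Fin r) ℝ := of label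

/-- The coordinate projection onto the source nodes. -/
noncomputable def sourceProj (r m n : ℕ) : Matrix (Node r m n) (Node r m n) ℝ :=
  diagonal fun x => if (dom x : ℕ) = 0 then 1 else 0

theorem score_eq (f : Node r m n → Fin k → ℝ) (b : Matrix (Fin k) (Fin r) ℝ) (x : Node r m n)
    (i : Fin r) : score f b x i = (featMat f * b) x i := by
  change ∑ j, b j i * f x j = ∑ j, f x j * b j i
  simp only [mul_comm]

/-- Varying one entry of `b` by `t` changes the loss by a quadratic in `t` without constant term. It
is never negative, so its discriminant forces the linear coefficient to vanish. -/
theorem normal_equation {η : ℝ} {f : Node r m n → Fin k → ℝ} {b : Matrix (Fin k) (Fin r) ℝ}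
    (h : IsHead η f b) (j : Fin k) (i : Fin r) :
    ∑ x ∈ source r m n, ((score f b x i - label x i) * f x j + η * b j i) = 0 := by
  set c : Matrix (Fin k) (Fin r) ℝ := Matrix.single j i 1 with hc
  have hsc (x : Node r m n) (i' : Fin r) : score f c x i' = if i' = i then f x j else 0 := by
    rw [score_eq, hc, mul_apply]
    by_cases hi : i' = i
    · subst hi; simp [featMat, single_apply]
    · simp [hi, Ne.symm hi]
  have hadd (t : ℝ) (x : Node r m n) (i' : Fin r) :
      score f (b + t • c) x i' = score f b x i' + t * score f c x i' := by
    simp [score_eq, Matrix.mul_add]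
  have hcc (j' : Fin k) (i' : Fin r) : c j' i' = if j = j' ∧ i = i' then 1 else 0 := by
    rw [hc, Matrix.single_apply]
  have key (t : ℝ) : headLoss η f (b + t • c) = headLoss η f b +
      (2 * ∑ x ∈ source r m n, ((score f b x i - label x i) * f x j + η * b j i)) * t +
      (∑ x ∈ source r m n, (f x j ^ 2 + η)) * (t * t) := by
    simp only [headLoss]
    rw [Finset.mul_sum (source r m n), Finset.sum_mul (source r m n),
      Finset.sum_mul (source r m n), ← Finset.sum_add_distrib,
      ← Finset.sum_add_distrib]
    refine Finset.sum_congr rfl fun x _ => ?_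
    have e1 : ∑ i', (score f (b + t • c) x i' - label x i') ^ 2 =
        ∑ i', (score f b x i' - label x i') ^ 2 +
          2 * t * ((score f b x i - label x i) * f x j) + t * t * f x j ^ 2 := by
      have : ∀ i', (score f (b + t • c) x i' - label x i') ^ 2 =
          (score f b x i' - label x i') ^ 2 + if i' = i then
            (2 * t * ((score f b x i - label x i) * f x j) + t * t * f x j ^ 2) else 0 := by
        intro i'
        rw [hadd, hsc]
        split_ifs with hi
        · subst hi; ring
        · ring
      simp only [this, Finset.sum_add_distrib, Finset.sum_ite_eq', Finset.mem_univ, if_true]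
      ring
    have e2 : ∑ j', ∑ i', (b + t • c) j' i' ^ 2 = ∑ j', ∑ i', b j' i' ^ 2 +
        2 * t * b j i + t * t := by
      have : ∀ j' i', (b + t • c) j' i' ^ 2 = b j' i' ^ 2 + if j' = j then (if i' = i then
          (2 * t * b j i + t * t) else 0) else 0 := by
        intro j' i'
        rw [Matrix.add_apply, Matrix.smul_apply, hcc, smul_eq_mul]
        by_cases h1 : j' = j <;> by_cases h2 : i' = i
        · subst h1 h2; simp; ring
        · simp [h1, h2, Ne.symm h2]
        · simp [h1, Ne.symm h1]
        · simp [h1, Ne.symm h1]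
      simp only [this, Finset.sum_add_distrib]
      simp
      ring
    rw [e1, e2]
    ring
  have hd := discrim_le_zero (a := ∑ x ∈ source r m n, (f x j ^ 2 + η))
    (b := 2 * ∑ x ∈ source r m n, ((score f b x i - label x i) * f x j + η * b j i)) (c := 0)
    (fun t => by have := h (b + t • c); rw [key] at this; linarith)
  rw [discrim] at hd
  nlinarith [sq_nonneg (∑ x ∈ source r m n, ((score f b x i - label x i) * f x j + η * b j i))]

/-- The dual weights of the ridge-regularized head. -/
theorem exists_dual_weights {η : ℝ} (hη : 0 < η) (hs : 0 < (source r m n).card)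
    {f : Node r m n → Fin k → ℝ} {b : Matrix (Fin k) (Fin r) ℝ} (h : IsHead η f b) :
    ∃ w : Matrix (Node r m n) (Fin r) ℝ, sourceProj r m n * w = w ∧
      (η * (source r m n).card) • w =
        sourceProj r m n * (labelMat r m n - featMat f * (featMat f)ᵀ * w) ∧
      featMat f * b = featMat f * (featMat f)ᵀ * w := by
  have hs' : (0 : ℝ) < (source r m n).card := by exact_mod_cast hs
  have hσ : 0 < η * (source r m n).card := by positivity
  set σ := η * (source r m n).card with hσdef
  -- The dual weights are the scaled source residuals. The penalty sits inside the sum over the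
  -- source, so the effective ridge is `η` times the number of source nodes.
  let w : Matrix (Node r m n) (Fin r) ℝ :=
    σ⁻¹ • (sourceProj r m n * (labelMat r m n - featMat f * b))
  have hEE : sourceProj r m n * sourceProj r m n = sourceProj r m n := by
    rw [sourceProj, diagonal_mul_diagonal]; congr 1; ext x; split_ifs <;> simp
  have hb : b = (featMat f)ᵀ * w := by
    ext j i
    have hn := normal_equation h j i
    rw [Finset.sum_add_distrib, Finset.sum_const, nsmul_eq_mul] at hn
    have : ((featMat f)ᵀ * w) j i =
        σ⁻¹ * -∑ x ∈ source r m n, (score f b x i - label x i) * f x j := by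
      rw [Matrix.mul_smul, Matrix.smul_apply, smul_eq_mul, mul_apply, source, Finset.sum_filter,
        ← Finset.sum_neg_distrib]
      congr 1
      refine Finset.sum_congr rfl fun x _ => ?_
      rw [sourceProj, diagonal_mul, Matrix.sub_apply, ← score_eq]
      simp only [transpose_apply, featMat, of_apply, labelMat]
      split_ifs <;> ring
    rw [this, eq_inv_mul_iff_mul_eq₀ hσ.ne', hσdef]
    linarith
  have hG : featMat f * b = featMat f * (featMat f)ᵀ * w := by
    conv_lhs => rw [hb]
    rw [Matrix.mul_assoc]
  refine ⟨w, ?_, ?_, hG⟩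
  · rw [Matrix.mul_smul, ← Matrix.mul_assoc, hEE]
  · rw [← hG, smul_smul, mul_inv_cancel₀ hσ.ne', one_smul]

/-- A misclassified target point has scores far from its scaled label. -/
theorem card_errors_le {f : Node r m n → Fin k → ℝ} {b : Matrix (Fin k) (Fin r) ℝ}
    {pred : Node r m n → Fin r} (h : IsPredictor f b pred) {ξ : ℝ} (hξ : 1 / 2 ≤ ξ) :
    (((target r m n).filter fun x => pred x ≠ cls x).card : ℝ) ≤
      8 * ∑ x ∈ target r m n, ∑ i, (score f b x i - ξ * label x i) ^ 2 := by
  rw [Finset.card_filter, Finset.mul_sum]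
  push_cast
  refine Finset.sum_le_sum fun x _ => ?_
  split_ifs with hx
  · have h1 : ∑ i ∈ {pred x, cls x}, (score f b x i - ξ * label x i) ^ 2 ≤
        ∑ i, (score f b x i - ξ * label x i) ^ 2 :=
      Finset.sum_le_sum_of_subset_of_nonneg (Finset.subset_univ _) fun _ _ _ => sq_nonneg _
    rw [Finset.sum_pair hx] at h1
    have h2 := h x (cls x)
    have h3 : label x (cls x) = label x (pred x) + 1 := by
      simp [label, hx]; ring
    rw [h3] at h1
    -- The two deviations differ by at least `ξ ≥ 1 / 2`, so their squares add up to at least `ξ ^ 2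
    -- / 2 ≥ 1 / 8`.
    nlinarith [sq_nonneg ((score f b x (pred x) - ξ * label x (pred x)) +
      (score f b x (cls x) - ξ * (label x (pred x) + 1)))]
  · exact mul_nonneg (by norm_num) (Finset.sum_nonneg fun _ _ => sq_nonneg _)

/-! ### Block matrices and the spectrum of the expected adjacency matrix. -/

/-- The matrix that replaces all coordinates by their average. -/
noncomputable def avgMat (n : ℕ) : Matrix (Fin n) (Fin n) ℝ := of fun _ _ => (n : ℝ)⁻¹

theorem avgMat_mul_self {n : ℕ} (hn : n ≠ 0) : avgMat n * avgMat n = avgMat n := by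
  ext i j
  have : (n : ℝ) ≠ 0 := by exact_mod_cast hn
  simp [avgMat, mul_apply, this]

theorem avgMat_mul_compl {n : ℕ} (hn : n ≠ 0) : avgMat n * (1 - avgMat n) = 0 := by
  rw [Matrix.mul_sub, avgMat_mul_self hn, Matrix.mul_one, sub_self]

theorem compl_mul_avgMat {n : ℕ} (hn : n ≠ 0) : (1 - avgMat n) * avgMat n = 0 := by
  rw [Matrix.sub_mul, avgMat_mul_self hn, Matrix.one_mul, sub_self]

theorem compl_mul_compl {n : ℕ} (hn : n ≠ 0) :
    (1 - avgMat n) * (1 - avgMat n) = 1 - avgMat n := by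
  rw [Matrix.mul_sub, compl_mul_avgMat hn, Matrix.mul_one, sub_zero]

theorem avgMat_transpose (n : ℕ) : (avgMat n)ᵀ = avgMat n := rfl

theorem trace_avgMat {n : ℕ} (hn : n ≠ 0) : trace (avgMat n) = 1 := by
  have : (n : ℝ) ≠ 0 := by exact_mod_cast hn
  simp [trace, avgMat, this]

/-- The matrix that averages over the nodes of each class and domain, and acts on the domains
and on the classes by the given matrices. -/
noncomputable def blockMat {r m : ℕ} (n : ℕ) (X : Matrix (Fin m) (Fin m) ℝ)
    (Y : Matrix (Fin r) (Fin r) ℝ) : Matrix (Node r m n) (Node r m n) ℝ :=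
  X ⊗ₖ (Y ⊗ₖ avgMat n)

/-- The matrix with eigenvalue `a` on constants, `c` on class contrasts, `d` on domain contrasts
and `e` on interactions of classes and domains. -/
noncomputable def specMat (r m n : ℕ) (a c d e : ℝ) : Matrix (Node r m n) (Node r m n) ℝ :=
  a • blockMat n (avgMat m) (avgMat r) + c • blockMat n (avgMat m) (1 - avgMat r) +
    d • blockMat n (1 - avgMat m) (avgMat r) + e • blockMat n (1 - avgMat m) (1 - avgMat r)

theorem blockMat_mul (hn : n ≠ 0) (X X' : Matrix (Fin m) (Fin m) ℝ)
    (Y Y' : Matrix (Fin r) (Fin r) ℝ) :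
    blockMat n X Y * blockMat n X' Y' = blockMat n (X * X') (Y * Y') := by
  rw [blockMat, blockMat, ← mul_kronecker_mul, ← mul_kronecker_mul, avgMat_mul_self hn, blockMat]

theorem blockMat_transpose (X : Matrix (Fin m) (Fin m) ℝ) (Y : Matrix (Fin r) (Fin r) ℝ) :
    (blockMat n X Y)ᵀ = blockMat n Xᵀ Yᵀ := rfl

/-- The four blocks are mutually orthogonal projections. This reduces all later matrix algebra to
arithmetic with four eigenvalues. -/
theorem specMat_mul (hr : r ≠ 0) (hm : m ≠ 0) (hn : n ≠ 0) (a c d e a' c' d' e' : ℝ) :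
    specMat r m n a c d e * specMat r m n a' c' d' e' =
      specMat r m n (a * a') (c * c') (d * d') (e * e') := by
  have z1 (Y : Matrix (Fin r) (Fin r) ℝ) : blockMat n (0 : Matrix (Fin m) (Fin m) ℝ) Y = 0 := by
    rw [blockMat, zero_kronecker]
  have z2 (X : Matrix (Fin m) (Fin m) ℝ) : blockMat n X (0 : Matrix (Fin r) (Fin r) ℝ) = 0 := by
    rw [blockMat, zero_kronecker, kronecker_zero]
  simp only [specMat, Matrix.mul_add, Matrix.add_mul, Matrix.smul_mul, Matrix.mul_smul,
    blockMat_mul hn, avgMat_mul_self hr, avgMat_mul_self hm, avgMat_mul_compl hr,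
    avgMat_mul_compl hm, compl_mul_avgMat hr, compl_mul_avgMat hm, compl_mul_compl hr,
    compl_mul_compl hm, z1, z2, smul_zero, add_zero, zero_add, smul_smul]
  simp only [mul_comm]

theorem specMat_isSymm (a c d e : ℝ) : (specMat r m n a c d e).IsSymm := by
  simp only [Matrix.IsSymm, specMat, transpose_add, transpose_smul, blockMat_transpose,
    transpose_sub, transpose_one, avgMat_transpose]

theorem specMat_add (a c d e a' c' d' e' : ℝ) :
    specMat r m n a c d e + specMat r m n a' c' d' e' =
      specMat r m n (a + a') (c + c') (d + d') (e + e') := by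
  simp only [specMat]; module

theorem smul_specMat (t a c d e : ℝ) :
    t • specMat r m n a c d e = specMat r m n (t * a) (t * c) (t * d) (t * e) := by
  simp only [specMat]; module

theorem trace_specMat (hr : r ≠ 0) (hm : m ≠ 0) (hn : n ≠ 0) (a c d e : ℝ) :
    trace (specMat r m n a c d e) = a + c * (r - 1) + d * (m - 1) + e * ((m - 1) * (r - 1)) := by
  simp only [specMat, trace_add, trace_smul, blockMat, trace_kronecker, trace_avgMat hr,
    trace_avgMat hm, trace_avgMat hn, trace_sub, trace_one, Fintype.card_fin, smul_eq_mul]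
  ring

theorem quadForm_specMat_nonneg (hr : r ≠ 0) (hm : m ≠ 0) (hn : n ≠ 0) {a c d e : ℝ}
    (ha : 0 ≤ a) (hc : 0 ≤ c) (hd : 0 ≤ d) (he : 0 ≤ e) (v : Node r m n → ℝ) :
    0 ≤ v ⬝ᵥ (specMat r m n a c d e *ᵥ v) := by
  have h : specMat r m n a c d e =
      specMat r m n √a √c √d √e * specMat r m n √a √c √d √e := by
    rw [specMat_mul hr hm hn]
    simp only [Real.mul_self_sqrt, ha, hc, hd, he]
  rw [h, ← mulVec_mulVec, dotProduct_mulVec, ← mulVec_transpose, specMat_isSymm, dotProduct]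
  exact Finset.sum_nonneg fun _ _ => mul_self_nonneg _

theorem trace_idempotent_mul_gram_nonneg {ι κ : Type*} [Fintype ι] [Fintype κ] {X : Matrix ι ι ℝ}
    (hX : X.IsSymm) (hXX : X * X = X) (F : Matrix ι κ ℝ) : 0 ≤ trace (X * (F * Fᵀ)) := by
  have : trace (X * (F * Fᵀ)) = frobSq (X * F) := by
    rw [frobSq_eq_trace', transpose_mul, hX, ← Matrix.mul_assoc (X * F), trace_mul_comm _ X,
      Matrix.mul_assoc X F, ← Matrix.mul_assoc X X, hXX]
  rw [this]
  exact frobSq_nonneg _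

theorem specMat_apply (a c d e : ℝ) (x x' : Node r m n) :
    specMat r m n a c d e x x' = (n : ℝ)⁻¹ * (
      a * ((m : ℝ)⁻¹ * (r : ℝ)⁻¹) +
      c * ((m : ℝ)⁻¹ * ((if cls x = cls x' then 1 else 0) - (r : ℝ)⁻¹)) +
      d * (((if dom x = dom x' then 1 else 0) - (m : ℝ)⁻¹) * (r : ℝ)⁻¹) +
      e * (((if dom x = dom x' then 1 else 0) - (m : ℝ)⁻¹) *
        ((if cls x = cls x' then 1 else 0) - (r : ℝ)⁻¹))) := by
  obtain ⟨dx, yx, ix⟩ := x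
  obtain ⟨dx', yx', ix'⟩ := x'
  have e1 : dom (dx, yx, ix) = dx := rfl
  have e2 : cls (dx, yx, ix) = yx := rfl
  have e3 : dom (dx', yx', ix') = dx' := rfl
  have e4 : cls (dx', yx', ix') = yx' := rfl
  rw [e1, e2, e3, e4]
  simp only [specMat, blockMat, Matrix.add_apply, Matrix.smul_apply, kronecker_apply, smul_eq_mul,
    Matrix.sub_apply, one_apply, avgMat, of_apply]
  ring

section Spectrum

/-- The eigenvalue on constants, per node of a class and domain, of the edge probabilities. -/
noncomputable def eigConst (r m : ℕ) (ρ α β γ : ℝ) : ℝ :=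
  ρ + (m - 1) * α + (r - 1) * β + (r - 1) * (m - 1) * γ

/-- The eigenvalue on class contrasts. -/
noncomputable def eigClass (m : ℕ) (ρ α β γ : ℝ) : ℝ := (m - 1) * (α - γ) + (ρ - β)

/-- The eigenvalue on domain contrasts. -/
noncomputable def eigDom (r : ℕ) (ρ α β γ : ℝ) : ℝ := (r - 1) * (β - γ) + (ρ - α)

/-- Self-pairs are also sampled with probability `ρ`, so the mean is exactly block constant, with no
diagonal correction. -/
theorem pairProb_eq_specMat (hr : r ≠ 0) (hm : m ≠ 0) (hn : n ≠ 0) (ρ α β γ : ℝ) :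
    (of (pairProb ρ α β γ) : Matrix (Node r m n) (Node r m n) ℝ) =
      specMat r m n (n * eigConst r m ρ α β γ) (n * eigClass m ρ α β γ) (n * eigDom r ρ α β γ)
        (n * (ρ - α - β + γ)) := by
  have hr' : (r : ℝ) ≠ 0 := by exact_mod_cast hr
  have hm' : (m : ℝ) ≠ 0 := by exact_mod_cast hm
  have hn' : (n : ℝ) ≠ 0 := by exact_mod_cast hn
  ext x x'
  rw [specMat_apply, of_apply, pairProb, eigConst, eigClass, eigDom]
  split_ifs <;> field_simp <;> ring

end Spectrum

theorem sum_label (i : Fin r) :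
    ∑ y : Fin r, ((if i = y then 1 else 0) - 1 / (r : ℝ)) = 0 := by
  have : (r : ℝ) ≠ 0 := by have := i.pos; positivity
  simp [this]

/-- The labels of the source nodes are propagated to all nodes. -/
theorem specMat_mul_source_label (hm : m ≠ 0) (hn : n ≠ 0) (a c d : ℝ) :
    specMat r m n a c d 0 * (sourceProj r m n * labelMat r m n) =
      (c / m) • labelMat r m n := by
  ext x i
  have hr : r ≠ 0 := i.pos.ne'
  have hr' : (r : ℝ) ≠ 0 := by exact_mod_cast hr
  have hm' : (m : ℝ) ≠ 0 := by exact_mod_cast hm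
  have hn' : (n : ℝ) ≠ 0 := by exact_mod_cast hn
  have h0 : ∀ d' : Fin m, d' ≠ ⟨0, Nat.pos_of_ne_zero hm⟩ → ∀ (y : Fin r) (j : Fin n),
      (sourceProj r m n * labelMat r m n) (d', y, j) i = 0 := by
    intro d' hd' y j
    have : (dom (d', y, j) : ℕ) ≠ 0 := fun h => hd' (Fin.ext h)
    rw [sourceProj, diagonal_mul, if_neg this, zero_mul]
  set d₀ : Fin m := ⟨0, Nat.pos_of_ne_zero hm⟩
  let L : Fin r → ℝ := fun y => (if i = y then 1 else 0) - 1 / (r : ℝ)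
  -- `K` collects the coefficients that do not depend on the class of the source node; they
  -- disappear because centred labels sum to zero over the classes. An interaction eigenvalue would
  -- leave a term depending on the domain of `x`.
  let K : ℝ := a * ((m : ℝ)⁻¹ * (r : ℝ)⁻¹) - c * ((m : ℝ)⁻¹ * (r : ℝ)⁻¹) +
    d * (((if dom x = d₀ then 1 else 0) - (m : ℝ)⁻¹) * (r : ℝ)⁻¹)
  have h1 : ∀ (y : Fin r) (j : Fin n), specMat r m n a c d 0 x (d₀, y, j) *
      (sourceProj r m n * labelMat r m n) (d₀, y, j) i =
      (n : ℝ)⁻¹ * (K * L y + if cls x = y then c / m * L y else 0) := by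
    intro y j
    have e1 : dom (d₀, y, j) = d₀ := rfl
    have e2 : cls (d₀, y, j) = y := rfl
    have e3 : labelMat r m n (d₀, y, j) i = L y := rfl
    have e4 : (d₀ : ℕ) = 0 := rfl
    rw [specMat_apply, sourceProj, diagonal_mul, e1, e2, e3, if_pos e4]
    simp only [K]
    split_ifs <;> ring
  rw [mul_apply, Fintype.sum_prod_type, Finset.sum_eq_single d₀
    (fun d' _ hd' => Finset.sum_eq_zero fun q _ => by rw [h0 d' hd', mul_zero]) (by simp),
    Fintype.sum_prod_type]
  simp only [h1, Finset.sum_const, Finset.card_univ, Fintype.card_fin, nsmul_eq_mul,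
    mul_inv_cancel_left₀ hn', Finset.sum_add_distrib, ← Finset.mul_sum]
  have h2 : ∑ y, L y = 0 := sum_label i
  rw [h2, mul_zero, zero_add, Finset.sum_ite_eq, if_pos (Finset.mem_univ _)]
  rfl

/-! ### Contrastive loss as matrix approximation. -/

/-- A pre-trained feature map yields a best low-rank approximation of the adjacency matrix. -/
theorem IsPretrained.best_approx {g : Graph r m n} {f : Node r m n → Fin k → ℝ}
    (h : IsPretrained g f) (hs : 0 < ∑ z, ∑ z', adj g z z')
    (hN : 0 < Fintype.card (Node r m n)) (V : Matrix (Node r m n) (Fin k) ℝ) :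
    frobSq (((∑ z, ∑ z', adj g z z') / (Fintype.card (Node r m n) : ℝ) ^ 2) •
      (featMat f * (featMat f)ᵀ) - adj g) ≤ frobSq (V * Vᵀ - adj g) := by
  set s := ∑ z, ∑ z', adj g z z' with hsdef
  have hN' : (0 : ℝ) < Fintype.card (Node r m n) := by exact_mod_cast hN
  set N : ℝ := (Fintype.card (Node r m n) : ℝ) with hNdef
  -- Completing the square entry by entry: the loss is a positive multiple of the approximation
  -- error, up to a constant independent of `f'`.
  have hloss (f' : Node r m n → Fin k → ℝ) : contrastiveLoss g f' =
      s⁻¹ ^ 2 * N ^ 2 * (frobSq ((s / N ^ 2) • (featMat f' * (featMat f')ᵀ) - adj g) -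
        frobSq (adj g)) := by
    simp only [contrastiveLoss, frobSq, Finset.mul_sum, ← Finset.sum_add_distrib,
      ← Finset.sum_sub_distrib]
    refine Finset.sum_congr rfl fun x _ => Finset.sum_congr rfl fun x' _ => ?_
    have hG : (featMat f' * (featMat f')ᵀ) x x' = f' x ⬝ᵥ f' x' := rfl
    rw [Matrix.sub_apply, Matrix.smul_apply, hG, smul_eq_mul, posPair, ← hsdef, ← hNdef]
    field_simp
    ring
  have hV := h (of.symm (√(N ^ 2 / s) • V))
  rw [hloss, hloss, mul_le_mul_iff_right₀ (by positivity), sub_le_sub_iff_right] at hV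
  have : (s / N ^ 2) • (featMat (of.symm (√(N ^ 2 / s) • V)) *
      (featMat (of.symm (√(N ^ 2 / s) • V)))ᵀ) = V * Vᵀ := by
    have e : featMat (of.symm (√(N ^ 2 / s) • V)) = √(N ^ 2 / s) • V := rfl
    rw [e, transpose_smul, Matrix.smul_mul, Matrix.mul_smul, smul_smul, smul_smul,
      mul_assoc, Real.mul_self_sqrt (by positivity), div_mul_div_cancel₀ (by positivity),
      div_self hs.ne', one_smul]
  rwa [this] at hV

theorem adj_eq (ρ α β γ : ℝ) (g : Graph r m n) :
    adj g = of (pairProb ρ α β γ) + noise (edgeProb ρ α β γ) g := by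
  ext x x'
  change (if g s(x, x') then (1 : ℝ) else 0) =
    pairProb ρ α β γ x x' + ((if g s(x, x') then 1 else 0) - pairProb ρ α β γ x x')
  ring

theorem sum_eq_quadForm {ι : Type*} [Fintype ι] (X : Matrix ι ι ℝ) :
    ∑ z, ∑ z', X z z' = (fun _ => (1 : ℝ)) ⬝ᵥ (X *ᵥ fun _ => 1) := by
  simp [dotProduct, mulVec]

theorem sum_specMat (hr : r ≠ 0) (hm : m ≠ 0) (hn : n ≠ 0) (a c d e : ℝ) :
    ∑ z, ∑ z', specMat r m n a c d e z z' = a * (r * m * n) := by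
  have hr' : (r : ℝ) ≠ 0 := by exact_mod_cast hr
  have hm' : (m : ℝ) ≠ 0 := by exact_mod_cast hm
  have hn' : (n : ℝ) ≠ 0 := by exact_mod_cast hn
  have hrow : ∀ z : Node r m n, ∑ z', specMat r m n a c d e z z' = a := by
    intro z
    have hy : ∑ y : Fin r, ((if cls z = y then (1 : ℝ) else 0) - (r : ℝ)⁻¹) = 0 := by
      simp [hr']
    have hy' : ∑ y : Fin r, ∑ _j : Fin n, ((if cls z = y then (1 : ℝ) else 0) - (r : ℝ)⁻¹) = 0 := by
      rw [Finset.sum_comm]; simp only [hy, Finset.sum_const_zero]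
    have hd : ∑ y : Fin m, ((if dom z = y then (1 : ℝ) else 0) - (m : ℝ)⁻¹) = 0 := by
      simp [hm']
    have e1 : ∀ (p : Fin m) (q : Fin r) (j : Fin n), dom (p, q, j) = p := fun _ _ _ => rfl
    have e2 : ∀ (p : Fin m) (q : Fin r) (j : Fin n), cls (p, q, j) = q := fun _ _ _ => rfl
    have e3 : ∀ (p : Fin m) (q : Fin r) (j : Fin n), specMat r m n a c d e z (p, q, j) =
        (n : ℝ)⁻¹ * (a * ((m : ℝ)⁻¹ * (r : ℝ)⁻¹) +
      c * ((m : ℝ)⁻¹ * ((if cls z = q then 1 else 0) - (r : ℝ)⁻¹)) +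
      d * (((if dom z = p then 1 else 0) - (m : ℝ)⁻¹) * (r : ℝ)⁻¹) +
      e * (((if dom z = p then 1 else 0) - (m : ℝ)⁻¹) *
        ((if cls z = q then 1 else 0) - (r : ℝ)⁻¹))) := by
      intro p q j
      rw [specMat_apply, e1 p q j, e2 p q j]
    rw [Fintype.sum_prod_type]
    simp only [Fintype.sum_prod_type, e3]
    simp only [Finset.sum_const, Finset.card_univ, Fintype.card_fin,
      nsmul_eq_mul, Finset.sum_add_distrib, ← Finset.mul_sum, hy',
      mul_zero, ← Finset.sum_mul, hd, zero_mul, add_zero]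
    field_simp
  simp only [hrow, Finset.sum_const, Finset.card_univ, Fintype.card_prod, Fintype.card_fin,
    nsmul_eq_mul]
  push_cast
  ring

/-- The rank-`k` part of the expected adjacency matrix. -/
noncomputable def signalMat (r m n : ℕ) (ρ α β γ : ℝ) : Matrix (Node r m n) (Node r m n) ℝ :=
  specMat r m n (n * eigConst r m ρ α β γ) (n * eigClass m ρ α β γ) (n * eigDom r ρ α β γ) 0

/-! ### Bounds for the eigenvalues. -/

section Eigenvalues

variable {ρ α β γ δ : ℝ}

theorem le_eigClass (hm : 2 ≤ m) (hδ : 0 < δ) (hα : δ ≤ α - γ) (hρβ : β < ρ) :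
    δ ≤ eigClass m ρ α β γ := by
  have : (2 : ℝ) ≤ m := by exact_mod_cast hm
  rw [eigClass]; nlinarith

theorem le_eigDom (hr : 2 ≤ r) (hδ : 0 < δ) (hβ : δ ≤ β - γ) (hρα : α < ρ) :
    δ ≤ eigDom r ρ α β γ := by
  have : (2 : ℝ) ≤ r := by exact_mod_cast hr
  rw [eigDom]; nlinarith

theorem eigClass_le (hr : 1 ≤ r) (hm : 1 ≤ m) (hγ : 0 ≤ γ) (hβ : γ ≤ β) :
    eigClass m ρ α β γ ≤ eigConst r m ρ α β γ := by
  have h1 : (1 : ℝ) ≤ r := by exact_mod_cast hr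
  have h2 : (1 : ℝ) ≤ m := by exact_mod_cast hm
  have : eigConst r m ρ α β γ - eigClass m ρ α β γ = r * β + r * (m - 1) * γ := by
    rw [eigConst, eigClass]; ring
  have : 0 ≤ r * β + r * (m - 1) * γ :=
    add_nonneg (mul_nonneg (by linarith) (by linarith))
      (mul_nonneg (mul_nonneg (by linarith) (by linarith)) hγ)
  linarith

theorem eigDom_le (hr : 1 ≤ r) (hm : 1 ≤ m) (hγ : 0 ≤ γ) (hα : γ ≤ α) :
    eigDom r ρ α β γ ≤ eigConst r m ρ α β γ := by
  have h1 : (1 : ℝ) ≤ r := by exact_mod_cast hr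
  have h2 : (1 : ℝ) ≤ m := by exact_mod_cast hm
  have : eigConst r m ρ α β γ - eigDom r ρ α β γ = m * α + m * (r - 1) * γ := by
    rw [eigConst, eigDom]; ring
  have : 0 ≤ m * α + m * (r - 1) * γ :=
    add_nonneg (mul_nonneg (by linarith) (by linarith))
      (mul_nonneg (mul_nonneg (by linarith) (by linarith)) hγ)
  linarith

theorem eigConst_le (hr : 1 ≤ r) (hm : 1 ≤ m) (hαρ : α ≤ ρ) (hβρ : β ≤ ρ) (hγρ : γ ≤ ρ) :
    eigConst r m ρ α β γ ≤ r * m * ρ := by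
  have h1 : (1 : ℝ) ≤ r := by exact_mod_cast hr
  have h2 : (1 : ℝ) ≤ m := by exact_mod_cast hm
  rw [eigConst]
  have e1 : (m - 1) * α ≤ (m - 1) * ρ := mul_le_mul_of_nonneg_left hαρ (by linarith)
  have e2 : (r - 1) * β ≤ (r - 1) * ρ := mul_le_mul_of_nonneg_left hβρ (by linarith)
  have e3 : ((r : ℝ) - 1) * (m - 1) * γ ≤ (r - 1) * (m - 1) * ρ :=
    mul_le_mul_of_nonneg_left hγρ (mul_nonneg (by linarith) (by linarith))
  nlinarith

end Eigenvalues

/-! ### The Gram matrix of the features is close to the signal. -/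

section Perturbation

theorem sq_nonneg_mul_le {n x y : ℝ} (hn : 0 ≤ n) (hx : 0 ≤ x) (hxy : x ≤ y) :
    (n * x) ^ 2 ≤ (n * y) ^ 2 :=
  pow_le_pow_left₀ (mul_nonneg hn hx) (mul_le_mul_of_nonneg_left hxy hn) 2

/-- Supplies the lower bound on the range of the signal projection that quadratic growth needs. -/
theorem quadForm_sq_specMat_ge (hr : r ≠ 0) (hm : m ≠ 0) (hn : n ≠ 0) {a c d b : ℝ}
    (ha : b ^ 2 ≤ a ^ 2) (hc : b ^ 2 ≤ c ^ 2) (hd : b ^ 2 ≤ d ^ 2) (v : Node r m n → ℝ) :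
    b ^ 2 * (v ⬝ᵥ (specMat r m n 1 1 1 0 *ᵥ v)) ≤
      (specMat r m n a c d 0 *ᵥ v) ⬝ᵥ (specMat r m n a c d 0 *ᵥ v) := by
  have h1 : (specMat r m n a c d 0 *ᵥ v) ⬝ᵥ (specMat r m n a c d 0 *ᵥ v) =
      v ⬝ᵥ ((specMat r m n a c d 0 * specMat r m n a c d 0) *ᵥ v) := by
    rw [dotProduct_mulVec, ← mulVec_transpose, specMat_isSymm, mulVec_mulVec, dotProduct_comm]
  have h2 : specMat r m n a c d 0 * specMat r m n a c d 0 = (b ^ 2) • specMat r m n 1 1 1 0 +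
      specMat r m n (a ^ 2 - b ^ 2) (c ^ 2 - b ^ 2) (d ^ 2 - b ^ 2) 0 := by
    rw [specMat_mul hr hm hn, smul_specMat, specMat_add]
    congr 1 <;> ring
  have h3 := quadForm_specMat_nonneg hr hm hn (sub_nonneg.2 ha) (sub_nonneg.2 hc)
    (sub_nonneg.2 hd) le_rfl v
  rw [h1, h2, add_mulVec, dotProduct_add, smul_mulVec, dotProduct_smul, smul_eq_mul]
  linarith

/-- The complement of the signal space splits into interactions and vectors with zero block
averages. A Gram matrix has nonnegative trace against both, so the second piece can be added for
free when `a ≥ 0`. -/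
theorem trace_gram_mul_interaction_le (hr : r ≠ 0) (hm : m ≠ 0) (hn : n ≠ 0)
    (F : Matrix (Node r m n) (Fin k) ℝ) {t a e : ℝ} (ht : 0 ≤ t) (ha : 0 ≤ a) (he : e ≤ a) :
    trace ((t • (F * Fᵀ)) * specMat r m n 0 0 0 e) ≤
      a * trace ((1 - specMat r m n 1 1 1 0) * (t • (F * Fᵀ))) := by
  set X := specMat r m n 0 0 0 1 with hX
  set R := 1 - specMat r m n 1 1 1 1 with hR
  have h1 : 1 - specMat r m n 1 1 1 0 = X + R := by
    rw [hX, hR, show specMat r m n 1 1 1 1 =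
      specMat r m n 1 1 1 0 + specMat r m n 0 0 0 1 by rw [specMat_add]; norm_num]
    abel
  have hXs : X.IsSymm := specMat_isSymm _ _ _ _
  have hXX : X * X = X := by rw [hX, specMat_mul hr hm hn]; norm_num
  have hRs : R.IsSymm := isSymm_one.sub (specMat_isSymm _ _ _ _)
  have hRR : R * R = R := by
    have : specMat r m n 1 1 1 1 * specMat r m n 1 1 1 1 = specMat r m n 1 1 1 1 := by
      rw [specMat_mul hr hm hn]; norm_num
    rw [hR, Matrix.mul_sub, Matrix.sub_mul, Matrix.sub_mul, this]; simp
  have hXG := trace_idempotent_mul_gram_nonneg hXs hXX F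
  have hRG := trace_idempotent_mul_gram_nonneg hRs hRR F
  have hQX : specMat r m n 0 0 0 e = e • X := by rw [hX, smul_specMat]; simp
  rw [h1, trace_mul_comm, hQX, Matrix.smul_mul, Matrix.mul_smul, Matrix.mul_smul,
    Matrix.add_mul, trace_smul, trace_smul, trace_smul, trace_add]
  simp only [smul_eq_mul]
  have e1 := mul_le_mul_of_nonneg_right he (mul_nonneg ht hXG)
  have e2 := mul_nonneg ha (mul_nonneg ht hRG)
  linarith

/-- The scale of the Gram matrix involves the random edge total `s`. Here `s` is replaced by its
mean `n * l * (q * n)`: the approximation error contributes 64 and the fluctuation of `s`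
contributes 8 to the constant 72. -/
theorem frobSq_rescale_sub_le {ι : Type*} [Fintype ι] {G B : Matrix ι ι ℝ}
    {s q n l κ τ δ : ℝ} (hq : 0 < q) (hn : 0 < n) (hδ : 0 < δ) (hl : δ ≤ l) (hκ : 0 ≤ κ)
    (hs : |s - n * l * (q * n)| ≤ τ * (q * n)) (hs' : n * l * (q * n) / 2 ≤ s)
    (hH : frobSq ((s / (q * n) ^ 2) • G - B) ≤ 8 * κ * τ ^ 2 * l ^ 2 / δ ^ 2)
    (hB : frobSq B ≤ κ * (n * l) ^ 2) :
    frobSq (G - (q / l) • B) ≤ 72 * κ * q ^ 2 * τ ^ 2 / δ ^ 2 := by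
  have hl0 : 0 < l := hδ.trans_le hl
  have hs0 : 0 < s := lt_of_lt_of_le (by positivity) hs'
  set H := (s / (q * n) ^ 2) • G with hHdef
  set c : ℝ := (q * n) ^ 2 / s with hc
  set c' : ℝ := q / l with hc'
  have hc0 : 0 ≤ c := by positivity
  have hc2 : c ≤ 2 * c' := by
    rw [hc, hc', div_le_iff₀ hs0]
    have : (q * n) ^ 2 = 2 * (q / l) * (n * l * (q * n) / 2) := by field_simp
    rw [this]
    gcongr
  have hcc : (c - c') ^ 2 ≤ 4 * c' ^ 2 * (τ ^ 2 / (n * l) ^ 2) := by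
    have h1 : c - c' = c * ((n * l * (q * n) - s) / (n * l * (q * n))) := by
      rw [hc, hc']; field_simp
    have h2 : |(n * l * (q * n) - s) / (n * l * (q * n))| ≤ τ / (n * l) := by
      rw [abs_div, abs_sub_comm, abs_of_pos (by positivity : 0 < n * l * (q * n)),
        div_le_div_iff₀ (by positivity) (by positivity)]
      calc _ ≤ τ * (q * n) * (n * l) := by gcongr
        _ = _ := by ring
    have h3 : ((n * l * (q * n) - s) / (n * l * (q * n))) ^ 2 ≤ (τ / (n * l)) ^ 2 := by
      rw [← sq_abs]; gcongr
    calc (c - c') ^ 2 = c ^ 2 * ((n * l * (q * n) - s) / (n * l * (q * n))) ^ 2 := by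
          rw [h1, mul_pow]
      _ ≤ (2 * c') ^ 2 * (τ / (n * l)) ^ 2 := by gcongr
      _ = _ := by rw [div_pow]; ring
  have hdec : G - c' • B = c • (H - B) + (c - c') • B := by
    have : c • H = G := by
      rw [hHdef, hc, smul_smul, div_mul_div_cancel₀ hs0.ne', div_self (by positivity), one_smul]
    rw [smul_sub, this, sub_smul]
    abel
  rw [hdec]
  have hfin : c' ^ 2 * l ^ 2 = q ^ 2 := by rw [hc', ← mul_pow]; congr 1; field_simp
  have hB0 := frobSq_nonneg B
  have hH0 := frobSq_nonneg (H - B)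
  calc frobSq (c • (H - B) + (c - c') • B)
      ≤ 2 * (c ^ 2 * frobSq (H - B)) + 2 * ((c - c') ^ 2 * frobSq B) := by
        rw [← frobSq_smul, ← frobSq_smul]; exact frobSq_add_le _ _
    _ ≤ 2 * ((2 * c') ^ 2 * (8 * κ * τ ^ 2 * l ^ 2 / δ ^ 2)) +
        2 * (4 * c' ^ 2 * (τ ^ 2 / (n * l) ^ 2) * (κ * (n * l) ^ 2)) := by gcongr
    _ = 64 * κ * (c' ^ 2 * l ^ 2) * τ ^ 2 / δ ^ 2 + 8 * κ * (c' ^ 2 * l ^ 2) * τ ^ 2 / l ^ 2 := by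
        field_simp; ring
    _ ≤ 64 * κ * (c' ^ 2 * l ^ 2) * τ ^ 2 / δ ^ 2 +
        8 * κ * (c' ^ 2 * l ^ 2) * τ ^ 2 / δ ^ 2 := by gcongr
    _ = 72 * κ * q ^ 2 * τ ^ 2 / δ ^ 2 := by rw [hfin]; ring

end Perturbation

theorem frobSq_signalMat_le {ρ α β γ δ : ℝ} (hr : 2 ≤ r) (hm : 2 ≤ m) (hn : 1 ≤ n)
    (hk : (k : ℝ) = r + m - 1) (hγ : 0 ≤ γ) (hδ : 0 < δ) (hα : δ ≤ α - γ) (hβ : δ ≤ β - γ)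
    (hαρ : α < ρ) (hβρ : β < ρ) :
    frobSq (signalMat r m n ρ α β γ) ≤ k * (n * eigConst r m ρ α β γ) ^ 2 := by
  have hnp : (0 : ℝ) ≤ n := Nat.cast_nonneg _
  have hr1 : (1 : ℝ) ≤ r := by exact_mod_cast (by omega : 1 ≤ r)
  have hm1 : (1 : ℝ) ≤ m := by exact_mod_cast (by omega : 1 ≤ m)
  rw [signalMat, frobSq_eq_trace, specMat_isSymm,
    specMat_mul (by omega) (by omega) (by omega), trace_specMat (by omega) (by omega) (by omega), hk]
  have h1 := sq_nonneg_mul_le hnp (hδ.le.trans (le_eigClass (m := m) hm hδ hα hβρ))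
    (eigClass_le (r := r) (by omega) (by omega) hγ (by linarith))
  have h2 := sq_nonneg_mul_le hnp (hδ.le.trans (le_eigDom (r := r) hr hδ hβ hαρ))
    (eigDom_le (m := m) (by omega) (by omega) hγ (by linarith))
  have e1 := mul_le_mul_of_nonneg_right h1 (sub_nonneg.2 hr1)
  have e2 := mul_le_mul_of_nonneg_right h2 (sub_nonneg.2 hm1)
  linarith

/-- The Gram matrix of the features is close to a multiple of the signal part. -/
theorem frobSq_gram_sub_le {ρ α β γ δ τ : ℝ} (hr : 2 ≤ r) (hm : 2 ≤ m) (hn : 1 ≤ n)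
    (hkeq : (k : ℝ) = r + m - 1)
    (hγ : 0 ≤ γ) (hδ : 0 < δ) (hα : δ ≤ α - γ) (hβ : δ ≤ β - γ) (hαρ : α < ρ) (hβρ : β < ρ)
    {g : Graph r m n} (hτ : τ ≤ n * δ / 2)
    (hZ : ∀ v, |v ⬝ᵥ (noise (edgeProb ρ α β γ) g *ᵥ v)| ≤ τ * (v ⬝ᵥ v))
    {f : Node r m n → Fin k → ℝ} (hf : IsPretrained g f) :
    frobSq (featMat f * (featMat f)ᵀ -
      (r * m / eigConst r m ρ α β γ) • signalMat r m n ρ α β γ) ≤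
      72 * k * (r * m) ^ 2 * τ ^ 2 / δ ^ 2 := by
  have hr0 : r ≠ 0 := by omega
  have hm0 : m ≠ 0 := by omega
  have hn0 : n ≠ 0 := by omega
  have hrp : (0 : ℝ) < r := by positivity
  have hmp : (0 : ℝ) < m := by positivity
  have hnp : (0 : ℝ) < n := by positivity
  have hlc := le_eigClass (m := m) hm hδ hα hβρ
  have hld := le_eigDom (r := r) hr hδ hβ hαρ
  have hlc1 : eigClass m ρ α β γ ≤ eigConst r m ρ α β γ :=
    eigClass_le (r := r) (by omega) (by omega) hγ (by linarith)
  have hld1 : eigDom r ρ α β γ ≤ eigConst r m ρ α β γ :=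
    eigDom_le (m := m) (by omega) (by omega) hγ (by linarith)
  have hgc : δ ≤ eigClass m ρ α β γ - (ρ - α - β + γ) := by
    have : (1 : ℝ) ≤ m := by exact_mod_cast (by omega : 1 ≤ m)
    rw [eigClass]; nlinarith
  have hgd : δ ≤ eigDom r ρ α β γ - (ρ - α - β + γ) := by
    have : (1 : ℝ) ≤ r := by exact_mod_cast (by omega : 1 ≤ r)
    rw [eigDom]; nlinarith
  have hpair := pairProb_eq_specMat hr0 hm0 hn0 ρ α β γ
  have hB2 := frobSq_signalMat_le hr hm hn hkeq hγ hδ hα hβ hαρ hβρ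
  have hadj := adj_eq ρ α β γ g
  rw [hpair] at hadj
  rw [signalMat] at hB2 ⊢
  generalize eigConst r m ρ α β γ = l1 at *
  generalize eigClass m ρ α β γ = lc at *
  generalize eigDom r ρ α β γ = ld at *
  generalize ρ - α - β + γ = l0 at *
  generalize noise (edgeProb ρ α β γ) g = Z at *
  set B := specMat r m n (n * l1) (n * lc) (n * ld) 0 with hBdef
  set P := specMat r m n 1 1 1 0 with hPdef
  set Q := specMat r m n 0 0 0 (n * l0) with hQdef
  have hA : adj g = B + Q + Z := by
    rw [hadj, hBdef, hQdef, specMat_add]; simp only [add_zero, zero_add]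
  have hl1 : 0 < l1 := by linarith
  have hcard : (Fintype.card (Node r m n) : ℝ) = r * m * n := by
    simp only [Fintype.card_prod, Fintype.card_fin]; push_cast; ring
  have hcardpos : 0 < Fintype.card (Node r m n) := by
    have : (0 : ℝ) < Fintype.card (Node r m n) := by rw [hcard]; positivity
    exact_mod_cast this
  set s := ∑ z, ∑ z', adj g z z' with hs
  have hsdev : |s - n * l1 * (r * m * n)| ≤ τ * (r * m * n) := by
    have h1 : s - n * l1 * (r * m * n) = (fun _ => (1 : ℝ)) ⬝ᵥ (Z *ᵥ fun _ => 1) := by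
      rw [← sum_eq_quadForm, hs, hadj,
        ← sum_specMat hr0 hm0 hn0 (n * l1) (n * lc) (n * ld) (n * l0)]
      simp only [Matrix.add_apply, Finset.sum_add_distrib]
      ring
    rw [h1]
    refine (hZ _).trans_eq ?_
    rw [← hcard]
    simp [dotProduct]
  have hslow : n * l1 * (r * m * n) / 2 ≤ s := by
    have h1 := (abs_le.1 hsdev).1
    have h2 : τ * (r * m * n) ≤ n * l1 / 2 * (r * m * n) := by
      gcongr
      exact hτ.trans (by gcongr; linarith)
    linarith
  have hspos : 0 < s := lt_of_lt_of_le (by positivity) hslow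
  set G := featMat f * (featMat f)ᵀ with hG
  refine frobSq_rescale_sub_le (s := s) (by positivity) hnp hδ (by linarith) (Nat.cast_nonneg k)
    hsdev hslow ?_ hB2
  have ht : 0 ≤ s / (r * m * n : ℝ) ^ 2 := by positivity
  set t := s / (r * m * n : ℝ) ^ 2
  have hHs : (t • G).IsSymm := by
    have : G.IsSymm := by rw [hG, Matrix.IsSymm, transpose_mul, transpose_transpose]
    exact this.smul t
  have hPB : P * B = B := by
    rw [hPdef, hBdef, specMat_mul hr0 hm0 hn0]; simp only [one_mul, mul_zero]
  have hBP : B * P = B := by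
    rw [hPdef, hBdef, specMat_mul hr0 hm0 hn0]; simp only [mul_one, mul_zero]
  have hPP : P * P = P := by rw [hPdef, specMat_mul hr0 hm0 hn0]; simp only [mul_one, mul_zero]
  have htrP : trace P = k := by rw [hPdef, trace_specMat hr0 hm0 hn0, hkeq]; ring
  have hPs : P.IsSymm := specMat_isSymm _ _ _ _
  have hBs : B.IsSymm := specMat_isSymm _ _ _ _
  have hrankP : P.rank = k := by
    exact_mod_cast (rank_eq_trace_of_idempotent hPs hPP).trans htrP
  have hrankB : B.rank ≤ k := by rw [← hBP, ← hrankP]; exact rank_mul_le_right _ _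
  have hrankH : (t • G).rank ≤ k := by
    rw [hG, ← Matrix.smul_mul]
    exact (rank_mul_le_right _ _).trans ((rank_le_card_height _).trans_eq (Fintype.card_fin _))
  obtain ⟨V, hV⟩ := exists_gram_factor hBs (fun v => quadForm_specMat_nonneg hr0 hm0 hn0
    (by positivity) (mul_nonneg hnp.le (by linarith)) (mul_nonneg hnp.le (by linarith)) le_rfl v)
    hrankB
  have hopt : frobSq (t • G - adj g) ≤ frobSq (B - adj g) := by
    have := hf.best_approx hspos hcardpos V
    rwa [hV, hcard] at this
  have hmin : δ ≤ min lc ld := le_min hlc hld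
  have hminc : min lc ld ≤ lc := min_le_left _ _
  have hmind : min lc ld ≤ ld := min_le_right _ _
  -- The interaction eigenvalue can be negative, and there are also zero eigenvalues outside the
  -- block-constant vectors. The gap must therefore be measured from `max l0 0`.
  have hgap : max l0 0 + δ ≤ min lc ld := by
    rw [← max_add_add_right]
    exact max_le (le_min (by linarith) (by linarith)) (by linarith)
  generalize min lc ld = b at *
  have hb0 : 0 ≤ b := by linarith
  have ha0 : 0 ≤ n * max l0 0 := by positivity
  have hbest := frobSq_sub_le_of_best_approx (a := n * max l0 0) (b := n * b)
    hHs hrankH hBs hrankB hPs hPP htrP hBP hPB ha0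
    (mul_lt_mul_of_pos_left (by linarith) hnp)
    (quadForm_sq_specMat_ge hr0 hm0 hn0 (sq_nonneg_mul_le hnp.le hb0 (by linarith))
      (sq_nonneg_mul_le hnp.le hb0 hminc) (sq_nonneg_mul_le hnp.le hb0 hmind))
    hA (by rw [hBdef, hQdef, specMat_mul hr0 hm0 hn0, trace_specMat hr0 hm0 hn0]; ring)
    (trace_gram_mul_interaction_le hr0 hm0 hn0 _ ht ha0
      (mul_le_mul_of_nonneg_left (le_max_left _ _) hnp.le)) hZ hopt
  rw [le_div_iff₀ (by positivity)]
  have h1 : (n * δ) ^ 2 ≤ (n * b - n * max l0 0) ^ 2 := by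
    rw [← mul_sub]
    exact sq_nonneg_mul_le hnp.le hδ.le (by linarith)
  have h2 : (n * b) ^ 2 ≤ (n * l1) ^ 2 := sq_nonneg_mul_le hnp.le hb0 (by linarith)
  have e1 := mul_le_mul_of_nonneg_right h1 (frobSq_nonneg (t • G - B))
  have e2 := mul_le_mul_of_nonneg_left h2 (by positivity : 0 ≤ 8 * (k : ℝ) * τ ^ 2)
  have h3 : (n : ℝ) ^ 2 * (frobSq (t • G - B) * δ ^ 2) ≤ n ^ 2 * (8 * k * τ ^ 2 * l1 ^ 2) := by
    linarith
  exact le_of_mul_le_mul_left h3 (by positivity)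

/-! ### Deterministic score bounds on graphs with small noise. -/

theorem card_source (hm : m ≠ 0) : (source r m n).card = r * n := by
  have : source r m n = ({⟨0, Nat.pos_of_ne_zero hm⟩} : Finset (Fin m)) ×ˢ Finset.univ := by
    ext x
    rw [source, Finset.mem_filter, Finset.mem_product, Finset.mem_singleton]
    exact ⟨fun h => ⟨Fin.ext h.2, Finset.mem_univ _⟩,
      fun h => ⟨Finset.mem_univ _, congrArg Fin.val h.1⟩⟩
  rw [this, Finset.card_product]
  simp

theorem le_card_target (hr : 1 ≤ r) (hm : 2 ≤ m) : n ≤ (target r m n).card := by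
  have hsub : ({⟨1, by omega⟩} : Finset (Fin m)) ×ˢ
      (({⟨0, by omega⟩} : Finset (Fin r)) ×ˢ (Finset.univ : Finset (Fin n))) ⊆ target r m n := by
    intro x hx
    rw [Finset.mem_product, Finset.mem_singleton] at hx
    refine Finset.mem_filter.2 ⟨Finset.mem_univ _, ?_⟩
    rw [dom, hx.1]
    exact one_ne_zero
  calc n = _ := by simp
    _ ≤ _ := Finset.card_le_card hsub

theorem sum_sq_label_le (x : Node r m n) : ∑ i, label x i ^ 2 ≤ 1 := by
  have hr : (0 : ℝ) < r := by exact_mod_cast (cls x).pos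
  have : ∀ i, label x i ^ 2 =
      (if i = cls x then 1 - 2 / (r : ℝ) else 0) + 1 / (r : ℝ) ^ 2 := by
    intro i
    rw [label]
    split_ifs <;> ring
  simp only [this, Finset.sum_add_distrib, Finset.sum_ite_eq', Finset.mem_univ, if_true,
    Finset.sum_const, Finset.card_univ, Fintype.card_fin, nsmul_eq_mul]
  have h2 : (r : ℝ) * (1 / (r : ℝ) ^ 2) = 1 / r := by field_simp
  have h3 : 2 / (r : ℝ) = 1 / r + 1 / r := by ring
  have h4 : 0 < 1 / (r : ℝ) := by positivity
  rw [h2, h3]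
  linarith

theorem frobSq_source_label_le (hm : m ≠ 0) :
    frobSq (sourceProj r m n * labelMat r m n) ≤ r * n := by
  have : frobSq (sourceProj r m n * labelMat r m n) = ∑ x ∈ source r m n, ∑ i, label x i ^ 2 := by
    rw [frobSq, source, Finset.sum_filter]
    refine Finset.sum_congr rfl fun x _ => ?_
    simp only [sourceProj, diagonal_mul, labelMat, of_apply]
    split_ifs <;> simp
  rw [this]
  calc ∑ x ∈ source r m n, ∑ i, label x i ^ 2 ≤ ∑ x ∈ source r m n, (1 : ℝ) :=
        Finset.sum_le_sum fun x _ => sum_sq_label_le x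
    _ = r * n := by simp [card_source hm]

theorem sourceProj_mul_self : sourceProj r m n * sourceProj r m n = sourceProj r m n := by
  rw [sourceProj, diagonal_mul_diagonal]; congr 1; ext x; split_ifs <;> simp

/-- The factor by which the learned head shrinks the labels. -/
noncomputable def shrinkage (r m : ℕ) (ρ α β γ η : ℝ) : ℝ :=
  eigClass m ρ α β γ / (eigClass m ρ α β γ + η * eigConst r m ρ α β γ)

/-- With `q = r * m`, the exponent 7 is 4 from the kernel error plus 3 from the size of the Gram
matrix, and `5616 = 2 * 72 * 39`. The powers of `n` cancel. -/
theorem ridge_bound_arith {q r n η δ K E Δ G : ℝ} (hq : 1 ≤ q) (hr : 1 ≤ r) (hn : 0 < n)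
    (hη : 0 < η) (hη1 : η ≤ 1) (hδ : 0 < δ) (hK : 0 < K) (hE : E ≤ r * n)
    (hΔ0 : 0 ≤ Δ) (hΔ : Δ ≤ 72 * K * q ^ 4 * n / δ ^ 2)
    (hG0 : 0 ≤ G) (hG : G ≤ 38 * q ^ 3 * n ^ 2) :
    2 / (η * (r * n)) ^ 2 * E * Δ * (1 + G / (η * (r * n)) ^ 2) ≤
      5616 * K / (η ^ 4 * δ ^ 2) * q ^ 7 := by
  have hr0 : 0 < r := by linarith
  have hq0 : 0 < q := by linarith
  have h1 : 1 + G / (η * (r * n)) ^ 2 ≤ 39 * q ^ 3 / η ^ 2 := by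
    have e1 : G / (η * (r * n)) ^ 2 ≤ 38 * q ^ 3 / η ^ 2 := by
      calc G / (η * (r * n)) ^ 2 ≤ 38 * q ^ 3 * n ^ 2 / (η * (1 * n)) ^ 2 := by gcongr
        _ = 38 * q ^ 3 / η ^ 2 := by field_simp
    have e2 : 1 ≤ q ^ 3 / η ^ 2 := by
      rw [le_div_iff₀ (by positivity), one_mul]
      exact (pow_le_one₀ hη.le hη1).trans (one_le_pow₀ hq)
    calc 1 + G / (η * (r * n)) ^ 2 ≤ q ^ 3 / η ^ 2 + 38 * q ^ 3 / η ^ 2 := add_le_add e2 e1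
      _ = _ := by ring
  calc 2 / (η * (r * n)) ^ 2 * E * Δ * (1 + G / (η * (r * n)) ^ 2)
      ≤ 2 / (η * (r * n)) ^ 2 * (r * n) * (72 * K * q ^ 4 * n / δ ^ 2) * (39 * q ^ 3 / η ^ 2) := by
        gcongr
    _ = 5616 * K / (η ^ 4 * δ ^ 2) * q ^ 7 / r := by field_simp; ring
    _ ≤ 5616 * K / (η ^ 4 * δ ^ 2) * q ^ 7 := div_le_self (by positivity) hr

/-- On graphs with small noise, the scores on the target data are close to the shrunken labels. -/
theorem sum_score_sub_le {ρ α β γ δ τ η K : ℝ} (hr : 1 ≤ r) (hm : 2 ≤ m) (hn : 1 ≤ n)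
    (hγ : 0 ≤ γ) (hδ : 0 < δ) (hα : δ ≤ α - γ) (hβ : δ ≤ β - γ) (hαρ : α < ρ) (hβρ : β < ρ)
    (hη : 0 < η) (hη1 : η ≤ 1) (hK : 0 < K) (hnK : 4 * K * (r * m / δ ^ 2) ≤ n)
    (hτ : τ ^ 2 = K * (r * m * n))
    {g : Graph r m n} (hZ : ∀ v, |v ⬝ᵥ (noise (edgeProb ρ α β γ) g *ᵥ v)| ≤ τ * (v ⬝ᵥ v))
    {f : Node r m n → Fin (r + m - 1) → ℝ} (hf : IsPretrained g f)
    {b : Matrix (Fin (r + m - 1)) (Fin r) ℝ} (hb : IsHead η f b) :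
    ∑ x ∈ target r m n, ∑ i, (score f b x i - shrinkage r m ρ α β γ η * label x i) ^ 2 ≤
      5616 * K / (η ^ 4 * δ ^ 2) * (r * m) ^ 7 := by
  have hm0 : m ≠ 0 := by omega
  have hn0 : n ≠ 0 := by omega
  have hr1 : (1 : ℝ) ≤ r := by exact_mod_cast hr
  have hm1 : (1 : ℝ) ≤ m := by exact_mod_cast (by omega : 1 ≤ m)
  have hn1 : (0 : ℝ) < n := by positivity
  have hq1 : (1 : ℝ) ≤ r * m := one_le_mul_of_one_le_of_one_le hr1 hm1
  have hlc := le_eigClass (m := m) hm hδ hα hβρ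
  have hlc1 : eigClass m ρ α β γ ≤ eigConst r m ρ α β γ :=
    eigClass_le (r := r) (by omega) (by omega) hγ (by linarith)
  have hl1 : 0 < eigConst r m ρ α β γ := by linarith
  have hcs : (source r m n).card = r * n := card_source hm0
  obtain ⟨w, hw1, hw2, hw3⟩ := exists_dual_weights hη (by rw [hcs]; positivity) hb
  have hσ : η * ((source r m n).card : ℝ) = η * (r * n) := by rw [hcs]; push_cast; ring
  rw [hσ] at hw2
  have hσ0 : 0 < η * (r * n : ℝ) := by positivity
  have hEsymm : (sourceProj r m n).IsSymm := isSymm_diagonal _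
  set θ : ℝ := r * n * eigClass m ρ α β γ / eigConst r m ρ α β γ with hθ
  have hθ0 : 0 ≤ θ := by
    have : 0 ≤ eigClass m ρ α β γ := by linarith
    positivity
  have hξ : θ / (θ + η * (r * n)) = shrinkage r m ρ α β γ η := by
    have : 0 < eigClass m ρ α β γ := by linarith
    rw [hθ, shrinkage]
    field_simp
  have hsum : ∑ x ∈ target r m n, ∑ i, (score f b x i - shrinkage r m ρ α β γ η * label x i) ^ 2 ≤
      frobSq (featMat f * (featMat f)ᵀ * w - (θ / (θ + η * (r * n))) • labelMat r m n) := by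
    rw [hξ, ← hw3]
    simp only [frobSq, Matrix.sub_apply, Matrix.smul_apply, ← score_eq, smul_eq_mul]
    exact Finset.sum_le_sum_of_subset_of_nonneg (Finset.subset_univ _)
      fun x _ _ => Finset.sum_nonneg fun i _ => sq_nonneg _
  refine hsum.trans ?_
  -- For one class the domain eigenvalue is only `ρ - α`, which `δ` does not bound below. But then
  -- all centred labels are zero, and the Gram matrix can serve as its own reference kernel.
  rcases hr.eq_or_lt with hr' | hr'
  · subst hr'
    have hY : labelMat 1 m n = 0 := by
      ext x i
      simp [labelMat, label, Subsingleton.elim i (cls x)]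
    refine (frobSq_ridge_sub_le (K := featMat f * (featMat f)ᵀ) hσ0 hθ0 hEsymm hw1
      sourceProj_mul_self hw2 (by simp [hY])).trans ?_
    rw [sub_self, hY]
    have h0 : frobSq (0 : Matrix (Node 1 m n) (Node 1 m n) ℝ) = 0 := by simp [frobSq]
    rw [h0, mul_zero, zero_mul]
    positivity
  · have hkeq : ((r + m - 1 : ℕ) : ℝ) = r + m - 1 := by
      rw [Nat.cast_sub (by omega)]; push_cast; ring
    have hkle : ((r + m - 1 : ℕ) : ℝ) ≤ r * m := by
      rw [hkeq]
      nlinarith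
    have hKq : K * (r * m) / δ ^ 2 ≤ n / 4 := by
      have : 4 * K * (r * m / δ ^ 2) = 4 * (K * (r * m) / δ ^ 2) := by ring
      linarith
    -- This is where the lower bound on `n` enters: it keeps the edge total above half of its mean.
    have hτn : τ ≤ n * δ / 2 := by
      refine le_of_sq_le_sq ?_ (by positivity)
      rw [hτ]
      rw [div_le_iff₀ (by positivity)] at hKq
      nlinarith
    set B := (r * m / eigConst r m ρ α β γ) • signalMat r m n ρ α β γ with hB
    have hΔ := frobSq_gram_sub_le hr' hm hn hkeq hγ hδ hα hβ hαρ hβρ hτn hZ hf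
    have hS := frobSq_signalMat_le (n := n) hr' hm hn hkeq hγ hδ hα hβ hαρ hβρ
    rw [← hB] at hΔ
    have hBK : B * (sourceProj r m n * labelMat r m n) = θ • labelMat r m n := by
      rw [hB, signalMat, Matrix.smul_mul, specMat_mul_source_label hm0 hn0, smul_smul, hθ]
      congr 1
      field_simp
    have hBfrob : frobSq B ≤ (r * m) ^ 3 * n ^ 2 := by
      rw [hB, frobSq_smul]
      calc (r * m / eigConst r m ρ α β γ) ^ 2 * frobSq (signalMat r m n ρ α β γ)
          ≤ (r * m / eigConst r m ρ α β γ) ^ 2 * (r * m * (n * eigConst r m ρ α β γ) ^ 2) := by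
            gcongr
            exact hS.trans (by gcongr)
        _ = _ := by field_simp
    have hΔ1 : frobSq (featMat f * (featMat f)ᵀ - B) ≤ 72 * K * (r * m) ^ 4 * n / δ ^ 2 := by
      refine hΔ.trans ?_
      rw [hτ]
      calc _ ≤ 72 * (r * m : ℝ) * (r * m) ^ 2 * (K * (r * m * n)) / δ ^ 2 := by gcongr
        _ = _ := by ring
    have hΔ2 : frobSq (featMat f * (featMat f)ᵀ - B) ≤ 18 * (r * m) ^ 3 * n ^ 2 := by
      refine hΔ1.trans ?_
      calc 72 * K * (r * m : ℝ) ^ 4 * n / δ ^ 2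
          = 72 * (r * m : ℝ) ^ 3 * n * (K * (r * m) / δ ^ 2) := by ring
        _ ≤ 72 * (r * m : ℝ) ^ 3 * n * (n / 4) := by gcongr
        _ = _ := by ring
    have hG : frobSq (featMat f * (featMat f)ᵀ) ≤ 38 * (r * m) ^ 3 * n ^ 2 := by
      have := frobSq_add_le (featMat f * (featMat f)ᵀ - B) B
      rw [sub_add_cancel] at this
      linarith
    refine (frobSq_ridge_sub_le hσ0 hθ0 hEsymm hw1 sourceProj_mul_self hw2 hBK).trans ?_
    exact ridge_bound_arith hq1 hr1 hn1 hη hη1 hδ hK (frobSq_source_label_le hm0)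
      (frobSq_nonneg _) hΔ1 (frobSq_nonneg _) hG

theorem shrinkage_mem {ρ α β γ η ε : ℝ} (hr : 1 ≤ r) (hm : 2 ≤ m) (hγ : 0 ≤ γ) (hα : γ < α)
    (hβ : γ < β) (hαρ : α < ρ) (hβρ : β < ρ) (hη : 0 < η)
    (hη' : η ≤ (α - γ) * ε / (2 * r * ρ)) :
    1 - ε ≤ shrinkage r m ρ α β γ η ∧ shrinkage r m ρ α β γ η ≤ 1 := by
  have hlc : 0 < eigClass m ρ α β γ :=
    (sub_pos.2 hα).trans_le (le_eigClass hm (sub_pos.2 hα) le_rfl hβρ)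
  have hlc1 : eigClass m ρ α β γ ≤ eigConst r m ρ α β γ :=
    eigClass_le (r := r) (by omega) (by omega) hγ hβ.le
  have hl := eigConst_le (r := r) (m := m) (by omega) (by omega) hαρ.le hβρ.le (by linarith : γ ≤ ρ)
  have hr0 : (0 : ℝ) < r := by exact_mod_cast hr
  have hm2 : (2 : ℝ) ≤ m := by exact_mod_cast hm
  have hρ : 0 < ρ := by linarith
  have hηl : 0 < η * eigConst r m ρ α β γ := mul_pos hη (hlc.trans_le hlc1)
  have hε : 0 ≤ ε := by
    by_contra! h
    have : (α - γ) * ε / (2 * r * ρ) ≤ 0 :=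
      div_nonpos_of_nonpos_of_nonneg (mul_nonpos_of_nonneg_of_nonpos (by linarith) h.le)
        (by positivity)
    linarith
  -- Combines `eigConst ≤ r * m * ρ` with `m / 2 ≤ m - 1`, valid for `m ≥ 2`; the latter is the
  -- source of the 2 in the bound on `η`.
  have hkey : η * eigConst r m ρ α β γ ≤ ε * eigClass m ρ α β γ := by
    calc η * eigConst r m ρ α β γ ≤ (α - γ) * ε / (2 * r * ρ) * (r * m * ρ) := by
          have h1 : 0 ≤ (α - γ) * ε / (2 * r * ρ) := hη.le.trans hη'
          have h2 := hlc.le.trans hlc1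
          gcongr
      _ = ε * (m / 2 * (α - γ)) := by field_simp
      _ ≤ ε * eigClass m ρ α β γ := by
          gcongr
          rw [eigClass]
          nlinarith
  rw [shrinkage]
  constructor
  · rw [le_div_iff₀ (by positivity)]
    nlinarith
  · exact div_le_one_of_le₀ (by linarith) (by positivity)

theorem edgeProb_mem {ρ α β γ : ℝ} (hγ : 0 ≤ γ) (hρ : ρ ≤ 1) (hα : γ < α) (hβ : γ < β)
    (hαρ : α < ρ) (hβρ : β < ρ) (e : Sym2 (Node r m n)) :
    0 ≤ edgeProb ρ α β γ e ∧ edgeProb ρ α β γ e ≤ 1 := by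
  induction e with
  | h x y =>
    change 0 ≤ pairProb ρ α β γ x y ∧ pairProb ρ α β γ x y ≤ 1
    rw [pairProb]
    split_ifs <;> constructor <;> linarith

/-! ### From the noise event to the probabilistic statements. -/

open MeasureTheory in
/-- Bounds for the scores and for the error of the predictor that hold with high probability. -/
theorem graphLaw_bound {ζ ε : ℝ} (hζ : 0 < ζ) (hε1 : ε < 1 / 2) (hr : 1 ≤ r)
    (hm : 2 ≤ m) {ρ α β γ : ℝ} (hγ : 0 ≤ γ) (hρ : ρ ≤ 1) (hmax : max α β < ρ)
    (hmin : γ < min α β) {η : ℝ} (hη : 0 < η) (hη' : η ≤ (α - γ) * ε / (2 * r * ρ))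
    (hn : 64 * (4 + ζ) * (r * m / (min (α - γ) (β - γ)) ^ 2) ≤ n) :
    1 - (n : ℝ) ^ (-ζ) ≤ (graphLaw r m n ρ α β γ).real
      {g | ∀ f : Node r m n → Fin (r + m - 1) → ℝ, IsPretrained g f →
        ∀ b : Matrix (Fin (r + m - 1)) (Fin r) ℝ, IsHead η f b →
          ∑ x ∈ target r m n, ∑ i,
              (score f b x i - shrinkage r m ρ α β γ η * label x i) ^ 2
              ≤ 718848 * (4 + ζ) / (η ^ 4 * (min (α - γ) (β - γ)) ^ 2) * ((r : ℝ) * m) ^ 7 ∧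
          ∀ pred : Node r m n → Fin r, IsPredictor f b pred →
            targetError pred ≤ 718848 * (4 + ζ) / (η ^ 4 * (min (α - γ) (β - γ)) ^ 2 * n) *
              ((r : ℝ) * m) ^ 7} := by
  obtain ⟨hαρ, hβρ⟩ := max_lt_iff.1 hmax
  obtain ⟨hα, hβ⟩ := lt_min_iff.1 hmin
  have hδ : 0 < min (α - γ) (β - γ) := lt_min (by linarith) (by linarith)
  have hδα : min (α - γ) (β - γ) ≤ α - γ := min_le_left _ _
  have hδβ : min (α - γ) (β - γ) ≤ β - γ := min_le_right _ _
  generalize min (α - γ) (β - γ) = δ at *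
  have hr0 : (1 : ℝ) ≤ r := by exact_mod_cast hr
  have hm0 : (2 : ℝ) ≤ m := by exact_mod_cast hm
  have hnpos : (0 : ℝ) < n := lt_of_lt_of_le (by positivity) hn
  have hn1 : 1 ≤ n := by exact_mod_cast hnpos
  obtain ⟨hξ, -⟩ := shrinkage_mem (r := r) hr hm hγ hα hβ hαρ hβρ hη hη'
  have hρ0 : 0 < ρ := by linarith
  have hη1 : η ≤ 1 := by
    refine hη'.trans (div_le_one_of_le₀ ?_ (by positivity))
    nlinarith
  have hprob : ∀ e, IsProbabilityMeasure (bernoulliLaw (edgeProb (r := r) (m := m) (n := n)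
      ρ α β γ e)) := fun e =>
    isProbabilityMeasure_bernoulliLaw (edgeProb_mem hγ hρ hα hβ hαρ hβρ e).1
      (edgeProb_mem hγ hρ hα hβ hαρ hβρ e).2
  have hcard : (Fintype.card (Node r m n) : ℝ) = r * m * n := by
    simp only [Fintype.card_prod, Fintype.card_fin]; push_cast; ring
  -- The noise event fails with probability exponentially small in the number of nodes, and `log n ≤
  -- n ≤ r * m * n` weakens this to a power of `n`.
  have hexp : Real.exp (-(ζ * Fintype.card (Node r m n))) ≤ (n : ℝ) ^ (-ζ) := by
    rw [Real.rpow_def_of_pos hnpos, hcard, Real.exp_le_exp]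
    have h1 := Real.log_le_self hnpos.le
    have h2 : (n : ℝ) ≤ r * m * n := le_mul_of_one_le_left hnpos.le (by nlinarith)
    nlinarith
  refine (sub_le_sub_left hexp 1).trans
    ((measure_noise_quadForm _ (edgeProb_mem hγ hρ hα hβ hαρ hβρ) hζ).trans ?_)
  rw [graphLaw]
  refine measureReal_mono fun g hg f hf b hb => ?_
  -- `K` is the square of the constant in the noise radius `4 * √((4 + ζ) * N)`. It yields the
  -- threshold `64 = 4 * 16` and, with the factor 8 per error, `718848 = 8 * 5616 * 16`.
  have hmain := sum_score_sub_le (K := 16 * (4 + ζ)) hr hm hn1 hγ hδ hδα hδβ hαρ hβρ hη hη1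
    (by positivity) (le_trans (le_of_eq (by ring)) hn)
    (by rw [mul_pow, Real.sq_sqrt (by positivity), hcard]; ring) hg hf hb
  set X := ∑ x ∈ target r m n, ∑ i, (score f b x i - shrinkage r m ρ α β γ η * label x i) ^ 2
  have h8 : 8 * X ≤ 718848 * (4 + ζ) / (η ^ 4 * δ ^ 2) * ((r : ℝ) * m) ^ 7 := by
    calc 8 * X ≤ 8 * (5616 * (16 * (4 + ζ)) / (η ^ 4 * δ ^ 2) * ((r : ℝ) * m) ^ 7) := by gcongr
      _ = _ := by ring
  have hX0 : 0 ≤ X := Finset.sum_nonneg fun _ _ => Finset.sum_nonneg fun _ _ => sq_nonneg _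
  refine ⟨by linarith, fun pred hpred => ?_⟩
  have hT : (n : ℝ) ≤ (target r m n).card := by exact_mod_cast le_card_target hr hm
  calc targetError pred ≤ 8 * X / n := by
        rw [targetError]
        exact div_le_div₀ (by positivity) (card_errors_le hpred (by linarith)) hnpos hT
    _ ≤ 718848 * (4 + ζ) / (η ^ 4 * δ ^ 2) * ((r : ℝ) * m) ^ 7 / n := by gcongr
    _ = _ := by field_simp

end SBM

end Auxiliary

theorem theorem1 :
    -- general case: `m` domains, feature dimension `r + m - 1`
    (∃ D : ℕ, ∀ ζ ε : ℝ, 0 < ζ → 0 < ε → ε < 1 / 2 →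
      ∃ C₁ C₂ : ℝ, 0 < C₁ ∧ 0 < C₂ ∧
      ∀ r m : ℕ, 1 ≤ r → 2 ≤ m →
      ∀ ρ α β γ : ℝ, 0 ≤ γ → ρ ≤ 1 → max α β < ρ → γ < min α β →
      ∀ η : ℝ, 0 < η → η ≤ (α - γ) * ε / (2 * r * ρ) →
      ∃ ξ : ℝ, 1 - ε ≤ ξ ∧ ξ ≤ 1 ∧
      ∀ n : ℕ, C₁ * (r * m / (min (α - γ) (β - γ)) ^ 2) ≤ n →
        1 - (n : ℝ) ^ (-ζ) ≤ (SBM.graphLaw r m n ρ α β γ).real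
          {g | ∀ f : SBM.Node r m n → Fin (r + m - 1) → ℝ, SBM.IsPretrained g f →
            ∀ b : Matrix (Fin (r + m - 1)) (Fin r) ℝ, SBM.IsHead η f b →
              ∑ x ∈ SBM.target r m n, ∑ i, (SBM.score f b x i - ξ * SBM.label x i) ^ 2
                  ≤ C₂ / (η ^ 4 * (min (α - γ) (β - γ)) ^ 2) * ((r : ℝ) * m) ^ D ∧
              ∀ pred : SBM.Node r m n → Fin r, SBM.IsPredictor f b pred →
                SBM.targetError pred
                  ≤ C₂ / (η ^ 4 * (min (α - γ) (β - γ)) ^ 2 * n) * ((r : ℝ) * m) ^ D}) ∧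
    -- two domains, feature dimension `r + 1`, probability `0.999`
    (∃ (D : ℕ) (C₁ C₂ : ℝ), 0 < C₁ ∧ 0 < C₂ ∧
      ∀ r : ℕ, 1 ≤ r →
      ∀ ρ α β γ : ℝ, 0 ≤ γ → ρ ≤ 1 → max α β < ρ → γ < min α β →
      ∀ η : ℝ, 0 < η → η < (α - γ) / (8 * r * ρ) →
      ∀ n : ℕ, C₁ * (r / (min (α - γ) (β - γ)) ^ 2) ≤ n →
        0.999 ≤ (SBM.graphLaw r 2 n ρ α β γ).real
          {g | ∀ f : SBM.Node r 2 n → Fin (r + 1) → ℝ, SBM.IsPretrained g f →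
            ∀ b : Matrix (Fin (r + 1)) (Fin r) ℝ, SBM.IsHead η f b →
              ∀ pred : SBM.Node r 2 n → Fin r, SBM.IsPredictor f b pred →
                SBM.targetError pred
                  ≤ C₂ / (η ^ 4 * (min α β - γ) ^ 2 * n) * (r : ℝ) ^ D}) := by
  constructor
  · refine ⟨7, fun ζ ε hζ _ hε1 => ⟨64 * (4 + ζ), 718848 * (4 + ζ), by positivity, by positivity,
      fun r m hr hm ρ α β γ hγ hρ hmax hmin η hη hη' => ?_⟩⟩
    obtain ⟨hαρ, hβρ⟩ := max_lt_iff.1 hmax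
    obtain ⟨hα, hβ⟩ := lt_min_iff.1 hmin
    obtain ⟨hξ, hξ1⟩ := SBM.shrinkage_mem (r := r) hr hm hγ hα hβ hαρ hβρ hη hη'
    exact ⟨SBM.shrinkage r m ρ α β γ η, hξ, hξ1, fun n hn =>
      SBM.graphLaw_bound hζ hε1 hr hm hγ hρ hmax hmin hη hη' hn⟩
  -- The general bound is used with `ζ = 1`, `ε = 1 / 4` and `m = 2`. The value 1000 exceeds the
  -- required `64 * 5 * 2` and also makes the failure probability `1 / n` at most `0.001`; `2 ^ 7`
  -- comes from `(r * 2) ^ 7`.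
  · refine ⟨7, 1000, 718848 * 5 * 2 ^ 7, by norm_num, by norm_num,
      fun r hr ρ α β γ hγ hρ hmax hmin η hη hη' n hn => ?_⟩
    have hr1 : (1 : ℝ) ≤ r := by exact_mod_cast hr
    obtain ⟨hαρ, hβρ⟩ := max_lt_iff.1 hmax
    obtain ⟨hα, hβ⟩ := lt_min_iff.1 hmin
    have hδ : 0 < min (α - γ) (β - γ) := lt_min (by linarith) (by linarith)
    have hδ1 : min (α - γ) (β - γ) ≤ 1 := (min_le_left _ _).trans (by linarith)
    have hη'' : η ≤ (α - γ) * (1 / 4) / (2 * r * ρ) := by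
      refine hη'.le.trans_eq ?_
      have : ρ ≠ 0 := by linarith
      field_simp
      norm_num
    have hn1000 : (1000 : ℝ) ≤ n := by
      refine le_trans ?_ hn
      have : 1 ≤ r / (min (α - γ) (β - γ)) ^ 2 := by
        rw [le_div_iff₀ (by positivity), one_mul]
        exact (pow_le_one₀ hδ.le hδ1).trans hr1
      linarith
    have hmain := SBM.graphLaw_bound (n := n) (ε := 1 / 4) one_pos (by norm_num) hr le_rfl hγ hρ
      hmax hmin hη hη'' (by
        refine le_trans ?_ hn
        have h0 : 0 ≤ r / (min (α - γ) (β - γ)) ^ 2 := by positivity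
        push_cast
        rw [mul_div_right_comm]
        linarith)
    have hmin_eq : min (α - γ) (β - γ) = min α β - γ := min_sub_sub_right α β γ
    rw [hmin_eq] at hmain hδ
    have hprob : ∀ e, MeasureTheory.IsProbabilityMeasure (SBM.bernoulliLaw
        (SBM.edgeProb (r := r) (m := 2) (n := n) ρ α β γ e)) := fun e =>
      isProbabilityMeasure_bernoulliLaw (SBM.edgeProb_mem hγ hρ hα hβ hαρ hβρ e).1
        (SBM.edgeProb_mem hγ hρ hα hβ hαρ hβρ e).2
    have hinv : (n : ℝ) ^ (-1 : ℝ) ≤ 0.001 := by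
      rw [Real.rpow_neg_one]
      calc (n : ℝ)⁻¹ ≤ (1000 : ℝ)⁻¹ := inv_anti₀ (by norm_num) hn1000
        _ = 0.001 := by norm_num
    refine le_trans (by linarith) (hmain.trans ?_)
    rw [SBM.graphLaw]
    refine MeasureTheory.measureReal_mono fun g hg f hf b hb pred hpred => ?_
    refine ((hg f hf b hb).2 pred hpred).trans_eq ?_
    push_cast
    rw [mul_pow]
    ring
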